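/- Let $n\ge 1$ and let $\mathbb Z^n$ be the ring with componentwise operations. Subrings contain the identity $(1,\dots,1)$ and are assumed to have finite index in $\mathbb Z^n$. The corank of such a subring $R\subseteq\mathbb Z^n$ is the rank of the finite abelian group $\mathbb Z^n/R$, that is, the number $r$ of its nontrivial invariant factors in $\mathbb Z^n/R\cong\mathbb Z/\alpha_1\oplus\cdots\oplus\mathbb Z/\alpha_r$ with all $\alpha_i>1$ and $\alpha_{i+1}\mid\alpha_i$; $R$ is cocyclic if $R=\mathbb Z^n$ or $R$ has corank $1$ (equivalently, if its corank is at most $1$). The proportion of subrings of $\mathbb Z^n$ with a property $P$ is $$\lim_{X\to\infty}\frac{\#\{R\subseteq\mathbb Z^n \text{ a subring}: [\mathbb Z^n:R]<X,\ R\text{ has } P\}}{\#\{R\subseteq\mathbb Z^n\text{ a subring}: [\mathbb Z^n:R]<X\}}.$$ Corollary. The proportion $p^R_{3,1}$ of subrings of $\mathbb Z^3$ that are cocyclic (that is, of corank at most $1$) exists and equals $$p^R_{3,1}=\zeta(2)\prod_p p^{-3}(p-1)^2(p+2)\approx 0.47168,$$ where the product over all primes $p$ converges. The proportion of subrings of $\mathbb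 Z^3$ that have corank exactly $2$ exists and equals $1-p^R_{3,1}\approx 0.52832$. Both decimals are correct to within $5\cdot 10^{-6}$. -/

import Mathlib

/-- The abelian group `G` is finite of rank `r`, i.e. it has exactly `r` nontrivial invariant
factors: `G ≅ ℤ/α₀ × ⋯ × ℤ/αᵣ₋₁` with all `αᵢ > 1` and `αᵢ₊₁ ∣ αᵢ`. -/
def HasFiniteRank (G : Type*) [AddCommGroup G] (r : ℕ) : Prop :=
  ∃ α : Fin r → ℕ, (∀ i, 1 < α i) ∧ (∀ i j, i ≤ j → α j ∣ α i) ∧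
    Nonempty (G ≃+ ((i : Fin r) → ZMod (α i)))

/-- The subring `R` of `ℤⁿ` (with componentwise multiplication) has finite index and corank `r`:
the finite abelian group `ℤⁿ / R` has rank `r`. -/
def HasCorank {n : ℕ} (R : Subring (Fin n → ℤ)) (r : ℕ) : Prop :=
  HasFiniteRank ((Fin n → ℤ) ⧸ R.toAddSubgroup) r

/-- The corank of `R` is at most `k`. -/
def HasCorankAtMost {n : ℕ} (k : ℕ) (R : Subring (Fin n → ℤ)) : Prop :=
  ∃ r ≤ k, HasCorank R r

/-- `R` is cocyclic: either `R = ℤⁿ` or `R` has corank `1`. -/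
def IsCocyclic {n : ℕ} (R : Subring (Fin n → ℤ)) : Prop :=
  R = ⊤ ∨ HasCorank R 1

/-- The finite-index subrings `R` of `ℤⁿ` with `[ℤⁿ : R] < X`. -/
def subringsBelow (n : ℕ) (X : ℝ) : Set (Subring (Fin n → ℤ)) :=
  {R | R.toAddSubgroup.FiniteIndex ∧ (R.toAddSubgroup.index : ℝ) < X}

/-- The proportion of those subrings of `ℤⁿ` of index less than `X` that satisfy `P`. -/
noncomputable def subringProportion (n : ℕ) (P : Subring (Fin n → ℤ) → Prop) (X : ℝ) : ℝ :=
  ({R ∈ subringsBelow n X | P R}.ncard : ℝ) / ((subringsBelow n X).ncard : ℝ)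

/-! A subring of `ℤ³` contains the diagonal, so it is the preimage of a rank two lattice under `v ↦
(v 0 - v 2, v 1 - v 2)`. In Hermite normal form the lattice has basis `(a, b)`, `(0, d)` with `0 ≤ b
< d`, its index is `a * d`, and closure under multiplication amounts to `d ∣ b (b - a)`. The smaller
invariant factor of the quotient is `gcd(a, b, d)`. Given the divisibility this gcd is `1` exactly
when `a` and `d` are coprime (`gcd_gcd_eq_one_iff_coprime`), and otherwise the corank is `2`.

Both counting functions are therefore sums over `ad = n` of the number of roots of `x (x - a)`
modulo `d`. They are multiplicative, and on powers of a prime they obey explicit recursions.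

Write such a function as `f = g * d₃`, with `d₃` the threefold divisor function and `g =
moebiusCubed f`. Since `g` vanishes at primes and `g(pᵉ) / pᵉ` is `O(p⁻²)` with geometric decay in
`e`, the series `∑ |g(n)| / n` converges. An elementary convolution argument
(`tendsto_sum_mul_zeta_pow_three`) then gives `∑_{n ≤ N} f(n) ∼ N T(N) ∑ g(n)/n`, where `T(N) = ∑_{n
≤ N} d(n)/n`. The same scale serves both functions, so it cancels in the ratio and neither its exact
asymptotics nor a Tauberian theorem is needed.

The sums `∑ g(n)/n` are Euler products: the local factor is `1 - 3p⁻² + 2p⁻³ = p⁻³ (p-1)² (p+2)` for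
cocyclic subrings and `1 - p⁻²` for all subrings. The second product is `1/ζ(2)`, whence the
proportion `ζ(2) E`. For the decimals, `E ζ(2)³` has factors `1 + O(p⁻³)`, so a finite product with
a telescoping tail bound suffices. -/

open Filter Topology

open ArithmeticFunction ArithmeticFunction.zeta ArithmeticFunction.Moebius

/-! ### Lattice description of subrings and their quotients -/

/-- The subring `{v | (v₀ - v₂, v₁ - v₂) ∈ ℤ(a, b) + ℤ(0, d)}` of `ℤ³`. -/
def latticeSubring (a b d : ℤ) (h : d ∣ b * (b - a)) : Subring (Fin 3 → ℤ) where
  carrier := {v | ∃ s t : ℤ, v 0 - v 2 = s * a ∧ v 1 - v 2 = s * b + t * d}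
  mul_mem' := by
    rintro v w ⟨s, t, h1, h2⟩ ⟨s', t', h1', h2'⟩
    obtain ⟨c, hc⟩ := h
    -- Subtracting multiples of the identity reduces to products of lattice vectors; the only
    -- nontrivial one is `(a, b)² = a (a, b) + (0, b (b - a))`, and `b (b - a) = d c`.
    refine ⟨v 2 * s' + w 2 * s + s * s' * a,
      v 2 * t' + w 2 * t + s * s' * c + s * b * t' + t * b * s' + t * t' * d, ?_, ?_⟩
    · have e1 : v 0 = v 2 + s * a := by linarith
      have e2 : w 0 = w 2 + s' * a := by linarith
      simp only [Pi.mul_apply, e1, e2]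
      ring
    · have e1 : v 1 = v 2 + (s * b + t * d) := by linarith
      have e2 : w 1 = w 2 + (s' * b + t' * d) := by linarith
      simp only [Pi.mul_apply, e1, e2]
      linear_combination s * s' * hc
  one_mem' := ⟨0, 0, by simp, by simp⟩
  add_mem' := by
    rintro v w ⟨s, t, h1, h2⟩ ⟨s', t', h1', h2'⟩
    refine ⟨s + s', t + t', ?_, ?_⟩ <;> simp only [Pi.add_apply] <;> linarith
  zero_mem' := ⟨0, 0, by simp, by simp⟩
  neg_mem' := by
    rintro v ⟨s, t, h1, h2⟩
    refine ⟨-s, -t, ?_, ?_⟩ <;> simp only [Pi.neg_apply] <;> linarith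

theorem mem_latticeSubring {a b d : ℤ} {h : d ∣ b * (b - a)} {v : Fin 3 → ℤ} :
    v ∈ latticeSubring a b d h ↔
      ∃ s t : ℤ, v 0 - v 2 = s * a ∧ v 1 - v 2 = s * b + t * d := Iff.rfl

/-- `b` is a unit modulo `gcd(a, d)`, and units modulo `gcd(a, d)` lift to units modulo `a`. The
lift differs from `b` by a multiple of `gcd(a, d)`, which Bézout splits into a multiple of `a`,
harmless for coprimality, and a multiple of `d`. -/
theorem exists_isCoprime_add_mul {a b d : ℕ} (ha : a ≠ 0) (h : Nat.gcd a (Nat.gcd b d) = 1) :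
    ∃ t : ℤ, IsCoprime (a : ℤ) (b + t * d) := by
  have : NeZero a := ⟨ha⟩
  have hg : Nat.gcd a d ∣ a := Nat.gcd_dvd_left a d
  have hb : Nat.Coprime b (Nat.gcd a d) := by
    rw [Nat.Coprime, ← h, ← Nat.gcd_assoc, ← Nat.gcd_assoc, Nat.gcd_comm b a]
  obtain ⟨y, hy⟩ := ZMod.unitsMap_surjective hg (ZMod.unitOfCoprime b hb)
  have hy' : (((y : ZMod a).val : ℤ) : ZMod (Nat.gcd a d)) = ((b : ℤ) : ZMod (Nat.gcd a d)) := by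
    have := congrArg Units.val hy
    rw [ZMod.unitsMap_val, ZMod.coe_unitOfCoprime] at this
    rw [Int.cast_natCast, Int.cast_natCast, ← this, ZMod.natCast_val]
  obtain ⟨s, hs⟩ := ((ZMod.intCast_eq_intCast_iff_dvd_sub _ _ _).1 hy'.symm)
  have hco : IsCoprime ((y : ZMod a).val : ℤ) (a : ℤ) :=
    Nat.isCoprime_iff_coprime.2 (ZMod.val_coe_unit_coprime y)
  refine ⟨Nat.gcdB a d * s, ?_⟩
  have key : (b : ℤ) + Nat.gcdB a d * s * d = (y : ZMod a).val + a * (- (Nat.gcdA a d * s)) := by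
    have := Nat.gcd_eq_gcd_ab a d
    rw [this] at hs
    linear_combination -hs
  rw [key]
  exact (IsCoprime.add_mul_left_right_iff).2 hco.symm

/-- An explicit Smith normal form: after dividing by `m = gcd(a, b, d)`, adding `t₀` times the
second basis vector to the first makes it primitive, and completing it to a basis of `ℤ²`
diagonalises the lattice. -/
theorem latticeSubring_quotient_equiv {a b d : ℕ} (ha : a ≠ 0) (hd : d ≠ 0)
    (h : (d : ℤ) ∣ b * ((b : ℤ) - a)) :
    ∃ N : ℕ, Nat.gcd a (Nat.gcd b d) ∣ N ∧ N * Nat.gcd a (Nat.gcd b d) = a * d ∧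
      Nonempty ((Fin 3 → ℤ) ⧸ (latticeSubring a b d h).toAddSubgroup ≃+
        ZMod N × ZMod (Nat.gcd a (Nat.gcd b d))) := by
  set m := Nat.gcd a (Nat.gcd b d) with hm
  have hm0 : 0 < m := Nat.gcd_pos_of_pos_left _ (Nat.pos_of_ne_zero ha)
  obtain ⟨a', ha'⟩ : m ∣ a := Nat.gcd_dvd_left _ _
  obtain ⟨b', hb'⟩ : m ∣ b := (Nat.gcd_dvd_right _ _).trans (Nat.gcd_dvd_left _ _)
  obtain ⟨d', hd'⟩ : m ∣ d := (Nat.gcd_dvd_right _ _).trans (Nat.gcd_dvd_right _ _)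
  have hg : Nat.gcd a' (Nat.gcd b' d') = 1 := by
    have : m * Nat.gcd a' (Nat.gcd b' d') = m * 1 := by
      rw [← Nat.gcd_mul_left, ← Nat.gcd_mul_left, ← ha', ← hb', ← hd', ← hm, mul_one]
    exact Nat.eq_of_mul_eq_mul_left hm0 this
  have ha0 : a' ≠ 0 := by rintro rfl; simp at ha'; exact ha ha'
  obtain ⟨t₀, u, w, huw⟩ := exists_isCoprime_add_mul ha0 hg
  set c : ℤ := b' + t₀ * d' with hc
  have hd0 : d' ≠ 0 := by rintro rfl; simp at hd'; exact hd hd'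
  have : NeZero m := ⟨hm0.ne'⟩
  have : NeZero (m * (a' * d')) := ⟨mul_ne_zero hm0.ne' (mul_ne_zero ha0 hd0)⟩
  refine ⟨m * (a' * d'), dvd_mul_right _ _, ?_, ?_⟩
  · rw [ha', hd']; ring
  -- `f₁` and `f₂` are unimodular coordinates on `ℤ²` sending the primitive vector `(a', c)` to `(0,
  -- 1)`; the lattice becomes `m a' d' ℤ × m ℤ`.
  let f₁ : (Fin 3 → ℤ) →+ ℤ :=
    { toFun := fun v => a' * (v 1 - v 2) - c * (v 0 - v 2)
      map_zero' := by simp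
      map_add' := fun v w => by simp only [Pi.add_apply]; ring }
  let f₂ : (Fin 3 → ℤ) →+ ℤ :=
    { toFun := fun v => u * (v 0 - v 2) + w * (v 1 - v 2)
      map_zero' := by simp
      map_add' := fun v w => by simp only [Pi.add_apply]; ring }
  let φ : (Fin 3 → ℤ) →+ ZMod (m * (a' * d')) × ZMod m :=
    ((Int.castAddHom _).comp f₁).prod ((Int.castAddHom _).comp f₂)
  have hφ : Function.Surjective φ := by
    rintro ⟨x, y⟩
    obtain ⟨x, rfl⟩ := ZMod.intCast_surjective x
    obtain ⟨y, rfl⟩ := ZMod.intCast_surjective y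
    refine ⟨![a' * y - w * x, u * x + c * y, 0], ?_⟩
    have e1 : f₁ ![a' * y - w * x, u * x + c * y, 0] = x := by
      simp [f₁]; linear_combination x * huw
    have e2 : f₂ ![a' * y - w * x, u * x + c * y, 0] = y := by
      simp [f₂]; linear_combination y * huw
    simp only [φ, AddMonoidHom.prod_apply, AddMonoidHom.comp_apply, e1, e2]
    rfl
  have hker : (latticeSubring a b d h).toAddSubgroup = φ.ker := by
    ext v
    have e1 : v ∈ φ.ker ↔ ((m * (a' * d') : ℕ) : ℤ) ∣ f₁ v ∧ (m : ℤ) ∣ f₂ v := by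
      rw [AddMonoidHom.mem_ker, AddMonoidHom.prod_apply, Prod.mk_eq_zero]
      exact and_congr (ZMod.intCast_zmod_eq_zero_iff_dvd _ _) (ZMod.intCast_zmod_eq_zero_iff_dvd _ _)
    have e2 : v ∈ (latticeSubring a b d h).toAddSubgroup ↔
      ∃ s t : ℤ, v 0 - v 2 = s * a ∧ v 1 - v 2 = s * b + t * d := Iff.rfl
    rw [e1, e2, ha', hb', hd']
    change _ ↔ _ ∣ (a' * (v 1 - v 2) - c * (v 0 - v 2)) ∧ _ ∣ u * (v 0 - v 2) + w * (v 1 - v 2)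
    push_cast
    constructor
    · rintro ⟨s, t, h1, h2⟩
      rw [h1, h2, hc]
      exact ⟨⟨t - t₀ * s, by ring⟩, ⟨u * s * a' + w * (s * b' + t * d'), by ring⟩⟩
    · rintro ⟨⟨q, hq⟩, ⟨r, hr⟩⟩
      refine ⟨r - w * d' * q, t₀ * (r - w * d' * q) + q, ?_, ?_⟩
      · linear_combination (-(v 0 - v 2)) * huw + a' * hr - w * hq
      · rw [hc] at huw hq
        linear_combination (-(v 1 - v 2) + m * d' * q) * huw + (b' + t₀ * d') * hr + u * hq
  exact ⟨(QuotientAddGroup.quotientAddEquivOfEq hker).trans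
    (QuotientAddGroup.quotientKerEquivOfSurjective φ hφ)⟩

/-! ### Rank and cyclicity -/

theorem HasFiniteRank.congr {G H : Type*} [AddCommGroup G] [AddCommGroup H] (e : G ≃+ H) {r : ℕ}
    (h : HasFiniteRank G r) : HasFiniteRank H r := by
  obtain ⟨α, h1, h2, ⟨f⟩⟩ := h
  exact ⟨α, h1, h2, ⟨e.symm.trans f⟩⟩

theorem HasFiniteRank.isAddCyclic {G : Type*} [AddCommGroup G] {r : ℕ} (hr : r ≤ 1)
    (h : HasFiniteRank G r) : IsAddCyclic G := by
  obtain ⟨α, h1, h2, ⟨f⟩⟩ := h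
  have : IsAddCyclic ((i : Fin r) → ZMod (α i)) := by
    interval_cases r
    · infer_instance
    · exact (AddEquiv.isAddCyclic (AddEquiv.piUnique fun i : Fin 1 => ZMod (α i))).2 inferInstance
  exact f.isAddCyclic.2 this

/-- A product of two cyclic groups is cyclic only for coprime orders, whereas here one order divides
the other and exceeds `1`. Cyclicity thus separates corank `2` from corank at most `1` without
uniqueness of invariant factors. -/
theorem not_isAddCyclic_of_hasFiniteRank_two {G : Type*} [AddCommGroup G]
    (h : HasFiniteRank G 2) : ¬ IsAddCyclic G := by
  obtain ⟨α, h1, h2, ⟨f⟩⟩ := h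
  rw [f.isAddCyclic, (RingEquiv.piFinTwo fun i => ZMod (α i)).toAddEquiv.isAddCyclic,
    AddGroup.isAddCyclic_prod_iff]
  rintro ⟨-, -, h⟩
  rw [Nat.card_zmod, Nat.card_zmod] at h
  have := Nat.Coprime.eq_one_of_dvd h.symm (h2 0 1 (by simp))
  have := h1 1
  omega

theorem hasFiniteRank_zmod_prod {N m : ℕ} (hN : N ≠ 0) (hm : 1 < m) (h : m ∣ N) :
    HasFiniteRank (ZMod N × ZMod m) 2 := by
  have hmN := Nat.le_of_dvd (Nat.pos_of_ne_zero hN) h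
  refine ⟨![N, m], ?_, ?_, ⟨(RingEquiv.piFinTwo fun i => ZMod ((![N, m] : Fin 2 → ℕ) i)).toAddEquiv.symm⟩⟩
  · intro i
    fin_cases i
    · exact hm.trans_le hmN
    · exact hm
  · intro i j hij
    fin_cases i <;> fin_cases j <;> simp_all

theorem exists_hasFiniteRank_zmod {N : ℕ} (hN : N ≠ 0) :
    HasFiniteRank (ZMod N) (if N = 1 then 0 else 1) := by
  split_ifs with h
  · subst h
    refine ⟨Fin.elim0, fun i => i.elim0, fun i => i.elim0, ⟨?_⟩⟩
    exact { Equiv.ofUnique (ZMod 1) ((i : Fin 0) → ZMod (i.elim0)) with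
      map_add' := fun x y => Subsingleton.elim _ _ }
  · refine ⟨fun _ => N, fun _ => show 1 < N by omega, fun _ _ _ => dvd_rfl, ⟨?_⟩⟩
    exact (AddEquiv.piUnique fun i : Fin 1 => ZMod N).symm

section latticeSubring

variable {a b d : ℕ} (ha : a ≠ 0) (hd : d ≠ 0) (h : (d : ℤ) ∣ b * ((b : ℤ) - a))

include ha hd

theorem index_latticeSubring : (latticeSubring a b d h).toAddSubgroup.index = a * d := by
  obtain ⟨N, -, h2, ⟨e⟩⟩ := latticeSubring_quotient_equiv ha hd h
  rw [AddSubgroup.index, Nat.card_congr e.toEquiv, Nat.card_prod, Nat.card_zmod, Nat.card_zmod, h2]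

theorem hasCorank_two_latticeSubring_iff :
    HasCorank (latticeSubring a b d h) 2 ↔ Nat.gcd a (Nat.gcd b d) ≠ 1 := by
  obtain ⟨N, h1, h2, ⟨e⟩⟩ := latticeSubring_quotient_equiv ha hd h
  have hNm : N * Nat.gcd a (Nat.gcd b d) ≠ 0 := by rw [h2]; positivity
  constructor
  · intro hr h1
    apply not_isAddCyclic_of_hasFiniteRank_two (hr.congr e)
    rw [h1, AddGroup.isAddCyclic_prod_iff]
    refine ⟨inferInstance, inferInstance, by simp⟩
  · intro hm
    have hm0 := right_ne_zero_of_mul hNm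
    exact (hasFiniteRank_zmod_prod (left_ne_zero_of_mul hNm) (by omega) h1).congr e.symm

theorem hasCorankAtMost_one_latticeSubring_iff :
    HasCorankAtMost 1 (latticeSubring a b d h) ↔ Nat.gcd a (Nat.gcd b d) = 1 := by
  obtain ⟨N, h1, h2, ⟨e⟩⟩ := latticeSubring_quotient_equiv ha hd h
  have hNm : N * Nat.gcd a (Nat.gcd b d) ≠ 0 := by rw [h2]; positivity
  constructor
  · rintro ⟨r, hr, hR⟩
    by_contra hm
    exact not_isAddCyclic_of_hasFiniteRank_two
      ((hasCorank_two_latticeSubring_iff ha hd h).2 hm) (HasFiniteRank.isAddCyclic hr hR)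
  · intro hm
    rw [hm] at e
    refine ⟨if N = 1 then 0 else 1, by split_ifs <;> simp, ?_⟩
    exact (exists_hasFiniteRank_zmod (left_ne_zero_of_mul hNm)).congr
      (e.trans AddEquiv.prodUnique).symm

end latticeSubring

theorem isCocyclic_iff_hasCorankAtMost_one {n : ℕ} (R : Subring (Fin n → ℤ)) :
    IsCocyclic R ↔ HasCorankAtMost 1 R := by
  have key : R = ⊤ ↔ HasCorank R 0 := by
    constructor
    · rintro rfl
      have : Subsingleton ((Fin n → ℤ) ⧸ (⊤ : Subring (Fin n → ℤ)).toAddSubgroup) :=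
        QuotientAddGroup.subsingleton_quotient_top
      refine ⟨Fin.elim0, fun i => i.elim0, fun i => i.elim0, ⟨?_⟩⟩
      have : Unique ((Fin n → ℤ) ⧸ (⊤ : Subring (Fin n → ℤ)).toAddSubgroup) :=
        uniqueOfSubsingleton 0
      exact { Equiv.ofUnique _ ((i : Fin 0) → ZMod (i.elim0)) with
        map_add' := fun x y => Subsingleton.elim _ _ }
    · rintro ⟨α, -, -, ⟨e⟩⟩
      have := e.toEquiv.subsingleton
      rw [eq_top_iff]
      intro x _
      exact (QuotientAddGroup.eq_zero_iff (N := R.toAddSubgroup) x).1 (Subsingleton.elim _ _)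
  constructor
  · rintro (h | h)
    · exact ⟨0, by simp, key.1 h⟩
    · exact ⟨1, le_rfl, h⟩
  · rintro ⟨r, hr, h⟩
    interval_cases r
    · exact Or.inl (key.2 h)
    · exact Or.inr h

/-! ### Uniqueness and existence of the normal form -/

theorem latticeSubring_injective {a b d a' b' d' : ℕ} (ha : a ≠ 0)
    (hb : b < d) (hb' : b' < d')
    (h : (d : ℤ) ∣ b * ((b : ℤ) - a)) (h' : (d' : ℤ) ∣ b' * ((b' : ℤ) - a'))
    (heq : latticeSubring a b d h = latticeSubring a' b' d' h') :
    a = a' ∧ b = b' ∧ d = d' := by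
  have hv : ∀ v : Fin 3 → ℤ, (∃ s t : ℤ, v 0 - v 2 = s * a ∧ v 1 - v 2 = s * b + t * d) ↔
      ∃ s t : ℤ, v 0 - v 2 = s * a' ∧ v 1 - v 2 = s * b' + t * d' := fun v => by
    rw [← mem_latticeSubring (h := h), heq, mem_latticeSubring]
  obtain ⟨s, t, h1, h2⟩ := (hv ![a, b, 0]).1 ⟨1, 0, by simp, by simp⟩
  obtain ⟨s', t', h1', h2'⟩ := (hv ![a', b', 0]).2 ⟨1, 0, by simp, by simp⟩
  simp at h1 h2 h1' h2'
  have haa : a = a' := Nat.dvd_antisymm (Int.natCast_dvd_natCast.1 ⟨s', by rw [h1', mul_comm]⟩)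
    (Int.natCast_dvd_natCast.1 ⟨s, by rw [h1, mul_comm]⟩)
  subst haa
  have ha0 : (a : ℤ) ≠ 0 := by exact_mod_cast ha
  obtain ⟨p, q, h3, h4⟩ := (hv ![0, d, 0]).1 ⟨0, 1, by simp, by simp⟩
  obtain ⟨p', q', h3', h4'⟩ := (hv ![0, d', 0]).2 ⟨0, 1, by simp, by simp⟩
  simp [ha] at h3 h4 h3' h4'
  subst h3 h3'
  have hdd : d = d' := Nat.dvd_antisymm
    (Int.natCast_dvd_natCast.1 ⟨q', by rw [h4']; ring⟩)
    (Int.natCast_dvd_natCast.1 ⟨q, by rw [h4]; ring⟩)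
  subst hdd
  have hs : s = 1 := by
    apply mul_right_cancel₀ ha0
    linarith
  subst hs
  refine ⟨rfl, ?_, rfl⟩
  have : (b : ℤ) ≡ b' [ZMOD d] := Int.modEq_iff_dvd.2 ⟨-t, by rw [h2]; ring⟩
  exact Nat.ModEq.eq_of_lt_of_lt (Int.natCast_modEq_iff.1 this) hb hb'

theorem exists_forall_mem_iff_dvd (H : AddSubgroup ℤ) {n : ℤ} (hn : n ≠ 0) (h : n ∈ H) :
    ∃ a : ℕ, a ≠ 0 ∧ ∀ z, z ∈ H ↔ (a : ℤ) ∣ z := by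
  obtain ⟨a, ha⟩ := Int.subgroup_cyclic H
  have key : ∀ z, z ∈ H ↔ (a.natAbs : ℤ) ∣ z := fun z => by
    rw [ha, AddSubgroup.mem_closure_singleton, Int.natAbs_dvd]
    exact ⟨fun ⟨k, hk⟩ => ⟨k, by rw [← hk, smul_eq_mul, mul_comm]⟩,
      fun ⟨k, hk⟩ => ⟨k, by rw [hk, smul_eq_mul, mul_comm]⟩⟩
  refine ⟨a.natAbs, fun h0 => hn ?_, key⟩
  have := (key n).1 h
  rwa [h0, Nat.cast_zero, zero_dvd_iff] at this

/-- `a` generates the image of `R` under `v 0 - v 2`, and `d` generates the slice `{y | (0, y, 0) ∈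
R}`. Both are nonzero because `R` contains the index times `ℤ³`. -/
theorem exists_eq_latticeSubring (R : Subring (Fin 3 → ℤ)) (hR : R.toAddSubgroup.FiniteIndex) :
    ∃ (a b d : ℕ) (h : (d : ℤ) ∣ b * ((b : ℤ) - a)),
      a ≠ 0 ∧ b < d ∧ R = latticeSubring a b d h := by
  have hidx : ∀ v : Fin 3 → ℤ, (R.toAddSubgroup.index • v) ∈ R := fun v =>
    AddSubgroup.nsmul_index_mem R.toAddSubgroup v
  have hn0 : R.toAddSubgroup.index ≠ 0 := hR.index_ne_zero
  set n := R.toAddSubgroup.index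
  let p : (Fin 3 → ℤ) →+ ℤ :=
    { toFun := fun v => v 0 - v 2
      map_zero' := by simp
      map_add' := fun v w => by simp only [Pi.add_apply]; ring }
  let i : ℤ →+ (Fin 3 → ℤ) :=
    { toFun := fun y => ![0, y, 0]
      map_zero' := by ext k; fin_cases k <;> rfl
      map_add' := fun v w => by ext k; fin_cases k <;> simp }
  have hone : ∀ z : ℤ, ![z, z, z] ∈ R := fun z => by
    have := intCast_mem R z
    convert this using 1
    ext k; fin_cases k <;> rfl
  have hn0' : (n : ℤ) ≠ 0 := by exact_mod_cast hn0
  obtain ⟨a, ha0, ha⟩ := exists_forall_mem_iff_dvd (R.toAddSubgroup.map p) hn0'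
    ⟨n • ![1, 0, 0], hidx _, by simp [p]⟩
  obtain ⟨d, hd0, hd⟩ := exists_forall_mem_iff_dvd (R.toAddSubgroup.comap i) hn0'
    (by
      change ![0, (n : ℤ), 0] ∈ R
      convert hidx ![0, 1, 0] using 1
      ext k; fin_cases k <;> simp)
  have hd' : ∀ z : ℤ, ![0, z, 0] ∈ R ↔ (d : ℤ) ∣ z := hd
  have hd1 : (0 : ℤ) < d := by positivity
  obtain ⟨v, hv, hva⟩ : (a : ℤ) ∈ R.toAddSubgroup.map p := (ha a).2 dvd_rfl
  change v 0 - v 2 = a at hva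
  have hb0 := Int.emod_nonneg (v 1 - v 2) hd1.ne'
  have hbd := Int.emod_lt_of_pos (v 1 - v 2) hd1
  obtain ⟨b, hb⟩ := Int.eq_ofNat_of_zero_le hb0
  rw [hb] at hbd
  have habR : ![(a : ℤ), b, 0] ∈ R := by
    have h1 := R.sub_mem (R.sub_mem hv (hone (v 2))) ((hd' _).2 (Dvd.intro ((v 1 - v 2) / d) rfl))
    convert h1 using 1
    ext k
    fin_cases k
    · simp [Matrix.vecHead, hva]
    · have := Int.emod_add_mul_ediv (v 1 - v 2) d
      simp [Matrix.vecHead, Matrix.vecTail]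
      linarith
    · simp [Matrix.vecHead, Matrix.vecTail]
  have hdiv : (d : ℤ) ∣ b * ((b : ℤ) - a) := by
    -- `(a, b, 0)² - a (a, b, 0) = (0, b (b - a), 0)` lies in the slice.
    rw [← hd']
    convert R.sub_mem (R.mul_mem habR habR) (R.zsmul_mem habR a) using 1
    ext k
    fin_cases k <;> simp
    ring
  refine ⟨a, b, d, hdiv, ha0, by exact_mod_cast hbd, ?_⟩
  ext w
  rw [mem_latticeSubring]
  constructor
  · intro hw
    obtain ⟨s, hs⟩ := (ha (w 0 - w 2)).1 ⟨w, hw, rfl⟩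
    obtain ⟨t, ht⟩ : (d : ℤ) ∣ w 1 - w 2 - s * b := by
      rw [← hd']
      convert R.sub_mem (R.sub_mem hw (hone (w 2))) (R.zsmul_mem habR s) using 1
      ext k
      fin_cases k <;> simp [Matrix.vecHead, Matrix.vecTail]
      linarith
    exact ⟨s, t, by linarith, by linarith⟩
  · rintro ⟨s, t, h1, h2⟩
    convert R.add_mem (R.add_mem (hone (w 2)) (R.zsmul_mem habR s))
      (R.zsmul_mem ((hd' _).2 (dvd_refl (d : ℤ))) t) using 1
    ext k
    fin_cases k <;> simp
    · linarith
    · linarith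

open scoped Classical in
/-- The number of finite-index subrings of `ℤ³` of index less than `X` satisfying `P`, where `P`
is expressed by `Q` in terms of the basis `(a, b), (0, d)`. -/
theorem ncard_subringsBelow {P : Subring (Fin 3 → ℤ) → Prop} {Q : ℕ → ℕ → ℕ → Prop}
    (hPQ : ∀ (a b d : ℕ) (h : (d : ℤ) ∣ b * ((b : ℤ) - a)), a ≠ 0 → b < d →
      (P (latticeSubring a b d h) ↔ Q a b d)) (X : ℝ) :
    {R ∈ subringsBelow 3 X | P R}.ncard = ∑ n ∈ Finset.range ⌈X⌉₊,
      ∑ x ∈ n.divisorsAntidiagonal,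
        ((Finset.range x.2).filter
          fun b : ℕ => (x.2 : ℤ) ∣ b * ((b : ℤ) - x.1) ∧ Q x.1 b x.2).card := by
  let F := (Finset.range ⌈X⌉₊).sigma fun n => n.divisorsAntidiagonal.sigma fun x =>
    (Finset.range x.2).filter fun b : ℕ => (x.2 : ℤ) ∣ b * ((b : ℤ) - x.1) ∧ Q x.1 b x.2
  have hF : F.card = ∑ n ∈ Finset.range ⌈X⌉₊, ∑ x ∈ n.divisorsAntidiagonal,
        ((Finset.range x.2).filter
          fun b : ℕ => (x.2 : ℤ) ∣ b * ((b : ℤ) - x.1) ∧ Q x.1 b x.2).card := by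
    simp only [F, Finset.card_sigma]
  have hmem : ∀ x : (_ : ℕ) × (_ : ℕ × ℕ) × ℕ, x ∈ (F : Set _) ↔ (x.1 : ℝ) < X ∧
      (x.2.1.1 * x.2.1.2 = x.1 ∧ x.1 ≠ 0) ∧ x.2.2 < x.2.1.2 ∧
        (x.2.1.2 : ℤ) ∣ x.2.2 * ((x.2.2 : ℤ) - x.2.1.1) ∧ Q x.2.1.1 x.2.2 x.2.1.2 := fun x => by
    simp only [F, Finset.mem_coe, Finset.mem_sigma, Finset.mem_range, Finset.mem_filter,
      Nat.mem_divisorsAntidiagonal, Nat.lt_ceil]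
  rw [← hF, ← Set.ncard_coe_finset]
  symm
  refine Set.ncard_congr (fun x hx => latticeSubring x.2.1.1 x.2.2 x.2.1.2
    ((hmem x).1 hx).2.2.2.1) ?_ ?_ ?_
  · rintro ⟨n, ⟨a, d⟩, b⟩ hx
    obtain ⟨h1, ⟨h2, h3⟩, h4, h5, h6⟩ := (hmem _).1 hx
    dsimp only at h1 h2 h3 h4 h5 h6 ⊢
    have ha : a ≠ 0 := by rintro rfl; simp at h2; exact h3 h2.symm
    have hd : d ≠ 0 := by omega
    have hi := index_latticeSubring ha hd h5
    refine ⟨⟨⟨?_⟩, ?_⟩, (hPQ a b d h5 ha h4).2 h6⟩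
    · rw [hi, h2]; exact h3
    · rw [hi, h2]; exact h1
  · rintro ⟨n, ⟨a, d⟩, b⟩ ⟨n', ⟨a', d'⟩, b'⟩ hx hx' heq
    obtain ⟨h1, ⟨h2, h3⟩, h4, h5, h6⟩ := (hmem _).1 hx
    obtain ⟨h1', ⟨h2', h3'⟩, h4', h5', h6'⟩ := (hmem _).1 hx'
    dsimp only at h1 h2 h3 h4 h5 h6 h1' h2' h3' h4' h5' h6'
    have ha : a ≠ 0 := by rintro rfl; simp at h2; exact h3 h2.symm
    obtain ⟨rfl, rfl, rfl⟩ := latticeSubring_injective ha h4 h4' h5 h5' heq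
    obtain rfl : n = n' := h2.symm.trans h2'
    rfl
  · rintro R ⟨⟨hR, hX⟩, hP⟩
    obtain ⟨a, b, d, h, ha, hb, rfl⟩ := exists_eq_latticeSubring R hR
    have hd : d ≠ 0 := by omega
    rw [index_latticeSubring ha hd h] at hX
    exact ⟨⟨a * d, ⟨a, d⟩, b⟩, (hmem _).2 ⟨hX, ⟨rfl, mul_ne_zero ha hd⟩, hb, h,
      (hPQ a b d h ha hb).1 hP⟩, rfl⟩

/-! ### Multiplicativity and root counts -/

/-- The arithmetic function `n ↦ ∑_{ad = n} F a d`. -/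
def antidiagonalSum (F : ℕ → ℕ → ℝ) : ArithmeticFunction ℝ where
  toFun n := ∑ x ∈ n.divisorsAntidiagonal, F x.1 x.2
  map_zero' := by simp

theorem antidiagonalSum_apply (F : ℕ → ℕ → ℝ) (n : ℕ) :
    antidiagonalSum F n = ∑ x ∈ n.divisorsAntidiagonal, F x.1 x.2 := rfl

theorem isMultiplicative_antidiagonalSum {F : ℕ → ℕ → ℝ} (h1 : F 1 1 = 1)
    (hF : ∀ a d a' d' : ℕ, Nat.Coprime (a * d) (a' * d') →
      F (a * a') (d * d') = F a d * F a' d') :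
    (antidiagonalSum F).IsMultiplicative := by
  refine ⟨by simp [antidiagonalSum_apply, h1], ?_⟩
  simp only [antidiagonalSum_apply]
  intro m n cop
  rw [Finset.sum_mul_sum, ← Finset.sum_product']
  symm
  -- Same bijection as for Dirichlet convolutions: factorisations of `m n` are products of
  -- factorisations of the coprime parts, recovered by gcds.
  apply Finset.sum_nbij fun ((i, j), k, l) ↦ (i * k, j * l)
  · rintro ⟨⟨a1, a2⟩, ⟨b1, b2⟩⟩ h
    simp only [Nat.mem_divisorsAntidiagonal, Ne, Finset.mem_product] at h
    rcases h with ⟨⟨rfl, ha⟩, ⟨rfl, hb⟩⟩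
    simp only [Nat.mem_divisorsAntidiagonal, mul_eq_zero, Ne]
    constructor
    · ring
    rw [mul_eq_zero] at *
    exact not_or_intro ha hb
  · simp only [Set.InjOn, Finset.mem_coe, Nat.mem_divisorsAntidiagonal, Finset.mem_product,
      Prod.mk_inj]
    rintro ⟨⟨a1, a2⟩, ⟨b1, b2⟩⟩ ⟨⟨h1, ha⟩, ⟨h2, hb⟩⟩ ⟨⟨c1, c2⟩, ⟨d1, d2⟩⟩ ⟨⟨h3, -⟩, ⟨h4, -⟩⟩ ⟨h5, h6⟩
    dsimp only at h1 h2 h3 h4 h5 h6 ⊢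
    have key : ∀ {x y z w : ℕ}, x ∣ m → y ∣ n → z ∣ m → w ∣ n → x * y = z * w → x = z ∧ y = w := by
      intro x y z w hx hy hz hw h
      have e1 : x ∣ z := (cop.of_dvd hx hw).dvd_of_dvd_mul_right (h ▸ dvd_mul_right x y)
      have e2 : z ∣ x := (cop.of_dvd hz hy).dvd_of_dvd_mul_right (h ▸ dvd_mul_right z w)
      have e3 : y ∣ w := (cop.of_dvd hz hy).symm.dvd_of_dvd_mul_left (h ▸ dvd_mul_left y x)
      have e4 : w ∣ y := (cop.of_dvd hx hw).symm.dvd_of_dvd_mul_left (h ▸ dvd_mul_left w z)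
      exact ⟨Nat.dvd_antisymm e1 e2, Nat.dvd_antisymm e3 e4⟩
    have k1 := key ⟨_, h1.symm⟩ ⟨_, h2.symm⟩ ⟨_, h3.symm⟩ ⟨_, h4.symm⟩ h5
    have k2 := key ⟨a1, by rw [← h1, mul_comm]⟩ ⟨b1, by rw [← h2, mul_comm]⟩
      ⟨c1, by rw [← h3, mul_comm]⟩ ⟨d1, by rw [← h4, mul_comm]⟩ h6
    simp [k1, k2]
  · simp only [Set.SurjOn, Set.subset_def, Finset.mem_coe, Nat.mem_divisorsAntidiagonal,
      Finset.mem_product, Set.mem_image]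
    rintro ⟨b1, b2⟩ h
    use ((b1.gcd m, b2.gcd m), (b1.gcd n, b2.gcd n))
    rw [← cop.gcd_mul _, ← cop.gcd_mul _, ← h.1,
      Nat.gcd_mul_gcd_of_coprime_of_mul_eq_mul cop h.1,
      Nat.gcd_mul_gcd_of_coprime_of_mul_eq_mul cop.symm _]
    · rw [Ne, mul_eq_zero, not_or] at h
      simp [h.2.1, h.2.2]
    rw [mul_comm n m, h.1]
  · simp only [Nat.mem_divisorsAntidiagonal, Finset.mem_product]
    rintro ⟨⟨a1, a2⟩, ⟨b1, b2⟩⟩ ⟨⟨rfl, ha⟩, ⟨rfl, hb⟩⟩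
    exact (hF _ _ _ _ cop).symm

theorem antidiagonalSum_prime_pow (F : ℕ → ℕ → ℝ) {p : ℕ} (hp : p.Prime) (e : ℕ) :
    antidiagonalSum F (p ^ e) = ∑ k ∈ Finset.range (e + 1), F (p ^ k) (p ^ (e - k)) := by
  rw [antidiagonalSum_apply, Nat.sum_divisorsAntidiagonal, Nat.sum_divisors_prime_pow hp]
  refine Finset.sum_congr rfl fun k hk => ?_
  rw [Nat.pow_div (by simpa [Nat.lt_succ_iff] using hk) hp.pos]

/-- The number of residues `x` modulo `d` with `x (x - a) = 0`. -/
noncomputable def rootCount (a d : ℕ) : ℕ := Nat.card {x : ZMod d // x * (x - a) = 0}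

theorem rootCount_eq_count {a d : ℕ} (hd : d ≠ 0) :
    rootCount a d = Nat.count (fun b : ℕ => (d : ℤ) ∣ b * ((b : ℤ) - a)) d := by
  have : NeZero d := ⟨hd⟩
  rw [rootCount, Nat.count_eq_card_filter_range, ← Set.ncard_coe_finset]
  change Set.ncard {x : ZMod d | x * (x - a) = 0} = _
  have key : ∀ b : ℕ, (b : ZMod d) * (b - a) = 0 ↔ (d : ℤ) ∣ b * ((b : ℤ) - a) := fun b => by
    rw [← ZMod.intCast_zmod_eq_zero_iff_dvd]
    push_cast
    rfl
  refine Set.ncard_congr (fun x _ => x.val) ?_ ?_ ?_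
  · intro x hx
    simp only [Finset.coe_filter, Finset.mem_range, Set.mem_ofPred_eq]
    refine ⟨ZMod.val_lt x, (key _).1 ?_⟩
    rw [ZMod.natCast_zmod_val]
    exact hx
  · intro x y _ _ h
    exact ZMod.val_injective d h
  · intro b hb
    simp only [Finset.coe_filter, Finset.mem_range, Set.mem_ofPred_eq] at hb
    exact ⟨b, (key b).2 hb.2, ZMod.val_cast_of_lt hb.1⟩

theorem rootCount_mul_right (a : ℕ) {d d' : ℕ} (h : Nat.Coprime d d') :
    rootCount a (d * d') = rootCount a d * rootCount a d' := by
  rw [rootCount, rootCount, rootCount, ← Nat.card_prod]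
  let e := ZMod.chineseRemainder h
  have he : ∀ x : ZMod (d * d'), x * (x - a) = 0 ↔
      (e x).1 * ((e x).1 - a) = 0 ∧ (e x).2 * ((e x).2 - a) = 0 := fun x => by
    rw [← Prod.mk_eq_zero]
    conv_lhs => rw [← map_eq_zero_iff e e.injective]
    rw [map_mul, map_sub, map_natCast]
    rfl
  exact Nat.card_congr ((e.toEquiv.subtypeEquiv he).trans Equiv.subtypeProdEquivProd)

/-- Scaling `x` by the unit `a'` multiplies `x (x - a)` by a unit square and turns `a` into `a a'`.
-/
theorem rootCount_mul_left (a : ℕ) {a' d : ℕ} (h : Nat.Coprime a' d) :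
    rootCount (a * a') d = rootCount a d := by
  let u := ZMod.unitOfCoprime a' h
  symm
  refine Nat.card_congr ((Units.mulLeft u).subtypeEquiv fun x => ?_)
  have : (u : ZMod d) * x * ((u : ZMod d) * x - ((a * a' : ℕ) : ZMod d)) =
      ((u * u : (ZMod d)ˣ) : ZMod d) * (x * (x - a)) := by
    rw [Units.val_mul, ZMod.coe_unitOfCoprime]
    push_cast
    ring
  rw [Units.mulLeft_apply, this, Units.mul_right_eq_zero]

theorem rootCount_mul_mul {a d a' d' : ℕ} (h : Nat.Coprime (a * d) (a' * d')) :
    rootCount (a * a') (d * d') = rootCount a d * rootCount a' d' := by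
  rw [rootCount_mul_right _ h.coprime_mul_left.coprime_mul_left_right,
    rootCount_mul_left _ h.coprime_mul_left.coprime_mul_right_right.symm, mul_comm a a',
    rootCount_mul_left _ h.coprime_mul_right.coprime_mul_left_right]

theorem rootCount_one_right (a : ℕ) : rootCount a 1 = 1 := by
  rw [rootCount_eq_count one_ne_zero]
  simp

theorem rootCount_one_left_prime_pow {p j : ℕ} (hp : p.Prime) (hj : j ≠ 0) :
    rootCount 1 (p ^ j) = 2 := by
  have h1 : 1 < p ^ j := Nat.one_lt_pow hj hp.one_lt
  rw [rootCount_eq_count (by positivity), Nat.count_eq_card_filter_range]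
  have : (Finset.range (p ^ j)).filter
      (fun b : ℕ => ((p ^ j : ℕ) : ℤ) ∣ b * ((b : ℤ) - (1 : ℕ))) = {0, 1} := by
    ext b
    simp only [Finset.mem_filter, Finset.mem_range, Finset.mem_insert, Finset.mem_singleton]
    constructor
    · rintro ⟨hb, hdvd⟩
      rcases b with _ | b
      · simp
      · right
        have h2 : p ^ j ∣ (b + 1) * b := by
          rw [← Int.natCast_dvd_natCast]
          convert hdvd using 1
          push_cast
          ring
        have hcop : Nat.Coprime (b + 1) b := by simp
        rcases (Nat.Coprime.isPrimePow_dvd_mul hcop (hp.isPrimePow.pow hj)).1 h2 with h3 | h3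
        · exact absurd (Nat.le_of_dvd (by omega) h3) (by omega)
        · rw [Nat.eq_zero_of_dvd_of_lt h3 (by omega)]
    · rintro (rfl | rfl) <;> simp <;> omega
  rw [this]
  rfl

theorem rootCount_prime_pow_prime {p i : ℕ} (hp : p.Prime) (hi : i ≠ 0) :
    rootCount (p ^ i) p = 1 := by
  rw [rootCount_eq_count hp.ne_zero, Nat.count_eq_card_filter_range]
  have : (Finset.range p).filter
      (fun b : ℕ => (p : ℤ) ∣ b * ((b : ℤ) - (p ^ i : ℕ))) = {0} := by
    ext b
    simp only [Finset.mem_filter, Finset.mem_range, Finset.mem_singleton]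
    constructor
    · rintro ⟨hb, hdvd⟩
      have h2 : (p : ℤ) ∣ b := by
        rcases (Nat.prime_iff_prime_int.1 hp).dvd_or_dvd hdvd with h | h
        · exact h
        · exact (dvd_sub_left (by push_cast; exact dvd_pow_self _ hi)).1 h
      exact Nat.eq_zero_of_dvd_of_lt (Int.natCast_dvd_natCast.1 h2) hb
    · rintro rfl
      simp [hp.pos]
  rw [this]
  rfl

theorem Nat.count_mul_of_periodic {Q : ℕ → Prop} [DecidablePred Q] {n : ℕ}
    (hQ : ∀ k, Q (n + k) ↔ Q k) (m : ℕ) : Nat.count Q (m * n) = m * Nat.count Q n := by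
  induction m with
  | zero => simp
  | succ m ih =>
    have : Nat.count (fun k => Q (n + k)) (m * n) = Nat.count Q (m * n) := by
      simp only [Nat.count_eq_card_filter_range, hQ]
    rw [add_mul, one_mul, add_comm, Nat.count_add, this, ih]
    ring

/-- A root must be divisible by `p`; writing it as `p c` and cancelling `p²` leaves the condition
for `c` modulo `p ^ j`. But `c` runs over `p ^ (j + 1)` values, that is `p` full periods. -/
theorem rootCount_prime_pow_succ {p : ℕ} (hp : p.Prime) (i j : ℕ) :
    rootCount (p ^ (i + 1)) (p ^ (j + 2)) = p * rootCount (p ^ i) (p ^ j) := by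
  have hpj : p ^ j ≠ 0 := by have := hp.ne_zero; positivity
  rw [rootCount_eq_count (by have := hp.ne_zero; positivity), rootCount_eq_count hpj]
  rw [← Nat.count_mul_of_periodic, Nat.count_eq_card_filter_range, Nat.count_eq_card_filter_range]
  · symm
    have hp0 : (p : ℤ) ≠ 0 := by exact_mod_cast hp.ne_zero
    have key : ∀ b : ℕ, ((p ^ (j + 2) : ℕ) : ℤ) ∣ ((p * b : ℕ) : ℤ) * ((p * b : ℕ) - (p ^ (i + 1) : ℕ))
        ↔ ((p ^ j : ℕ) : ℤ) ∣ b * ((b : ℤ) - (p ^ i : ℕ)) := fun b => by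
      have e1 : ((p * b : ℕ) : ℤ) * ((p * b : ℕ) - (p ^ (i + 1) : ℕ)) =
        (p : ℤ) ^ 2 * (b * ((b : ℤ) - (p ^ i : ℕ))) := by push_cast; ring
      have e2 : ((p ^ (j + 2) : ℕ) : ℤ) = (p : ℤ) ^ 2 * (p ^ j : ℕ) := by push_cast; ring
      rw [e1, e2]
      exact mul_dvd_mul_iff_left (by positivity)
    refine Finset.card_nbij (fun b => p * b) ?_ ?_ ?_
    · intro b hb
      simp only [Finset.coe_filter, Finset.mem_range, Set.mem_ofPred_eq] at hb ⊢
      refine ⟨?_, (key b).2 hb.2⟩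
      calc p * b < p * (p * p ^ j) := Nat.mul_lt_mul_of_pos_left hb.1 hp.pos
        _ = p ^ (j + 2) := by ring
    · intro b _ b' _ h
      exact Nat.eq_of_mul_eq_mul_left hp.pos h
    · intro b hb
      simp only [Finset.coe_filter, Finset.mem_range, Set.mem_ofPred_eq] at hb
      have hdvd : (p : ℤ) ∣ b * ((b : ℤ) - (p ^ (i + 1) : ℕ)) :=
        (Int.natCast_dvd_natCast.2 (dvd_pow_self p (by omega))).trans hb.2
      have h2 : (p : ℤ) ∣ b := by
        rcases (Nat.prime_iff_prime_int.1 hp).dvd_or_dvd hdvd with h | h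
        · exact h
        · exact (dvd_sub_left (by push_cast; exact dvd_pow_self _ (by omega))).1 h
      obtain ⟨c, rfl⟩ := Int.natCast_dvd_natCast.1 h2
      refine ⟨c, ?_, rfl⟩
      simp only [Finset.coe_filter, Finset.mem_range, Set.mem_ofPred_eq]
      refine ⟨?_, (key c).1 hb.2⟩
      apply lt_of_mul_lt_mul_left (a := p) _ (Nat.zero_le _)
      calc p * c < p ^ (j + 2) := hb.1
        _ = p * (p * p ^ j) := by ring
  · intro k
    rw [← ZMod.intCast_zmod_eq_zero_iff_dvd, ← ZMod.intCast_zmod_eq_zero_iff_dvd]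
    have e3 : ((p : ZMod (p ^ j)) ^ j) = 0 := by
      rw [← Nat.cast_pow]; exact ZMod.natCast_self _
    push_cast
    rw [e3, zero_add]

/-! ### The two counting functions at prime powers -/

/-- The number of subrings of `ℤ³` of index `n`. -/
noncomputable def subringCount : ArithmeticFunction ℝ :=
  antidiagonalSum fun a d => rootCount a d

/-- The number of cocyclic subrings of `ℤ³` of index `n`. -/
noncomputable def cocyclicCount : ArithmeticFunction ℝ :=
  antidiagonalSum fun a d => if Nat.Coprime a d then rootCount a d else 0

theorem isMultiplicative_subringCount : subringCount.IsMultiplicative := by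
  apply isMultiplicative_antidiagonalSum
  · rw [rootCount_one_right, Nat.cast_one]
  · intro a d a' d' h
    rw [rootCount_mul_mul h, Nat.cast_mul]

theorem isMultiplicative_cocyclicCount : cocyclicCount.IsMultiplicative := by
  apply isMultiplicative_antidiagonalSum
  · simp [rootCount_one_right]
  · intro a d a' d' h
    have : Nat.Coprime (a * a') (d * d') ↔ Nat.Coprime a d ∧ Nat.Coprime a' d' := by
      rw [Nat.coprime_mul_iff_left, Nat.coprime_mul_iff_right, Nat.coprime_mul_iff_right]
      have h1 := h.coprime_mul_right.coprime_mul_left_right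
      have h2 := h.coprime_mul_left.coprime_mul_right_right.symm
      tauto
    rw [rootCount_mul_mul h]
    simp only [this, ite_and]
    split_ifs <;> simp

/-- Coprimality leaves only `a = 1`, with two roots, and `d = 1`, with one. -/
theorem cocyclicCount_prime_pow {p : ℕ} (hp : p.Prime) (e : ℕ) :
    cocyclicCount (p ^ (e + 1)) = 3 := by
  rw [cocyclicCount, antidiagonalSum_prime_pow _ hp, Finset.sum_range_succ, Finset.sum_range_succ',
    Finset.sum_eq_zero]
  · simp [rootCount_one_right, rootCount_one_left_prime_pow hp]
    norm_num
  · intro k hk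
    rw [Finset.mem_range] at hk
    rw [if_neg]
    rw [Nat.coprime_pow_left_iff (by omega), Nat.coprime_pow_right_iff (by omega), Nat.coprime_self]
    exact hp.ne_one

/-- The terms `a = 1`, `d = p` and `d = 1` contribute `2 + 1 + 1`; in all others a factor `p` comes
out by `rootCount_prime_pow_succ`. -/
theorem subringCount_prime_pow_add_three {p : ℕ} (hp : p.Prime) (e : ℕ) :
    subringCount (p ^ (e + 3)) = p * subringCount (p ^ e) + 4 := by
  simp only [subringCount, antidiagonalSum_prime_pow _ hp]
  rw [Finset.sum_range_succ, Finset.sum_range_succ, Finset.sum_range_succ']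
  have e1 : e + 2 + 1 - (e + 2) = 1 := by omega
  rw [e1, Nat.sub_self, pow_zero, pow_one, rootCount_one_right,
    rootCount_prime_pow_prime (i := e + 2) hp (by omega), Nat.sub_zero,
    rootCount_one_left_prime_pow (j := e + 3) hp (by omega), Finset.mul_sum]
  have : ∀ k ∈ Finset.range (e + 1), (rootCount (p ^ (k + 1)) (p ^ (e + 2 + 1 - (k + 1))) : ℝ) =
      p * rootCount (p ^ k) (p ^ (e - k)) := fun k hk => by
    rw [Finset.mem_range] at hk
    rw [show e + 2 + 1 - (k + 1) = e - k + 2 by omega, rootCount_prime_pow_succ hp]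
    push_cast
    rfl
  rw [Finset.sum_congr rfl this]
  push_cast
  ring

theorem subringCount_prime {p : ℕ} (hp : p.Prime) : subringCount p = 3 := by
  have := antidiagonalSum_prime_pow (fun a d => (rootCount a d : ℝ)) hp 1
  rw [pow_one] at this
  rw [subringCount, this]
  have h2 := rootCount_one_left_prime_pow hp one_ne_zero
  simp [Finset.sum_range_succ, rootCount_one_right] at h2 ⊢
  rw [h2]
  norm_num

theorem subringCount_prime_sq {p : ℕ} (hp : p.Prime) : subringCount (p ^ 2) = 4 := by
  have h2 := rootCount_one_left_prime_pow hp two_ne_zero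
  have h3 := rootCount_prime_pow_prime hp one_ne_zero
  rw [pow_one] at h3
  simp [subringCount, antidiagonalSum_prime_pow _ hp, Finset.sum_range_succ, rootCount_one_right,
    h2, h3]
  norm_num

/-- A prime dividing `a` and `d` divides `b (b - a)`, hence `b`. -/
theorem gcd_gcd_eq_one_iff_coprime {a b d : ℕ} (h : (d : ℤ) ∣ b * ((b : ℤ) - a)) :
    Nat.gcd a (Nat.gcd b d) = 1 ↔ Nat.Coprime a d := by
  constructor
  · intro h1
    rw [Nat.coprime_iff_gcd_eq_one] at *
    by_contra hne
    obtain ⟨p, hp, hpg⟩ := Nat.exists_prime_and_dvd hne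
    have hpa := hpg.trans (Nat.gcd_dvd_left a d)
    have hpd := hpg.trans (Nat.gcd_dvd_right a d)
    have h2 : (p : ℤ) ∣ b := by
      rcases (Nat.prime_iff_prime_int.1 hp).dvd_or_dvd ((Int.natCast_dvd_natCast.2 hpd).trans h)
        with h | h
      · exact h
      · exact (dvd_sub_left (Int.natCast_dvd_natCast.2 hpa)).1 h
    have := Nat.dvd_gcd hpa (Nat.dvd_gcd (Int.natCast_dvd_natCast.1 h2) hpd)
    rw [h1] at this
    exact hp.one_lt.ne' (Nat.dvd_one.1 this)
  · intro h1
    exact Nat.eq_one_of_dvd_one (h1 ▸ Nat.dvd_gcd (Nat.gcd_dvd_left _ _)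
      ((Nat.gcd_dvd_right _ _).trans (Nat.gcd_dvd_right _ _)))

theorem ncard_subringsBelow_eq (X : ℝ) :
    ((subringsBelow 3 X).ncard : ℝ) = ∑ n ∈ Finset.range ⌈X⌉₊, subringCount n := by
  have h := ncard_subringsBelow (P := fun _ => True) (Q := fun _ _ _ => True)
    (fun _ _ _ _ _ _ => Iff.rfl) X
  simp only [and_true] at h
  change (({R | R ∈ subringsBelow 3 X}.ncard : ℕ) : ℝ) = _
  rw [h]
  push_cast
  refine Finset.sum_congr rfl fun n _ => Finset.sum_congr rfl fun x hx => ?_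
  dsimp only
  rw [rootCount_eq_count (Nat.right_ne_zero_of_mem_divisorsAntidiagonal hx),
    Nat.count_eq_card_filter_range]

theorem ncard_isCocyclic_eq (X : ℝ) :
    ({R ∈ subringsBelow 3 X | IsCocyclic R}.ncard : ℝ) =
      ∑ n ∈ Finset.range ⌈X⌉₊, cocyclicCount n := by
  rw [ncard_subringsBelow (Q := fun a _ d => Nat.Coprime a d) (fun a b d h ha hb => by
    rw [isCocyclic_iff_hasCorankAtMost_one, hasCorankAtMost_one_latticeSubring_iff ha (by omega),
      gcd_gcd_eq_one_iff_coprime h]) X]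
  push_cast
  refine Finset.sum_congr rfl fun n _ => Finset.sum_congr rfl fun x hx => ?_
  dsimp only
  split_ifs with h
  · rw [rootCount_eq_count (Nat.right_ne_zero_of_mem_divisorsAntidiagonal hx),
      Nat.count_eq_card_filter_range]
    refine congrArg Nat.cast (congrArg Finset.card (Finset.ext fun b => ?_))
    simp only [Finset.mem_filter, and_iff_left h]
  · simp [h]

theorem ncard_hasCorank_two_eq (X : ℝ) :
    ({R ∈ subringsBelow 3 X | HasCorank R 2}.ncard : ℝ) =
      ∑ n ∈ Finset.range ⌈X⌉₊, subringCount n - ∑ n ∈ Finset.range ⌈X⌉₊, cocyclicCount n := by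
  rw [ncard_subringsBelow (Q := fun a _ d => ¬ Nat.Coprime a d) (fun a b d h ha hb => by
    rw [hasCorank_two_latticeSubring_iff ha (by omega), Ne, gcd_gcd_eq_one_iff_coprime h]) X,
    ← Finset.sum_sub_distrib]
  push_cast
  refine Finset.sum_congr rfl fun n _ => ?_
  rw [subringCount, cocyclicCount, antidiagonalSum_apply, antidiagonalSum_apply,
    ← Finset.sum_sub_distrib]
  refine Finset.sum_congr rfl fun x hx => ?_
  split_ifs with h
  · simp [h]
  · rw [rootCount_eq_count (Nat.right_ne_zero_of_mem_divisorsAntidiagonal hx),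
      Nat.count_eq_card_filter_range]
    simp only [h, not_false_eq_true, and_true, sub_zero]

/-! ### Growth of the threefold divisor sum -/

/-- The arithmetic function `n ↦ 1 / n`. -/
noncomputable def invFunction : ArithmeticFunction ℝ := ⟨fun n => (n : ℝ)⁻¹, by simp⟩

theorem invFunction_apply (n : ℕ) : invFunction n = (n : ℝ)⁻¹ := rfl

theorem invFunction_mul_invFunction_apply (n : ℕ) :
    (invFunction * invFunction) n = ((ζ : ArithmeticFunction ℝ) * ζ) n / n := by
  rw [mul_apply, mul_apply, Finset.sum_div]
  refine Finset.sum_congr rfl fun x hx => ?_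
  have h1 := Nat.left_ne_zero_of_mem_divisorsAntidiagonal hx
  have h2 := Nat.right_ne_zero_of_mem_divisorsAntidiagonal hx
  rw [Nat.mem_divisorsAntidiagonal] at hx
  simp [← hx.1, invFunction_apply, h1, h2, mul_comm]

theorem zeta_mul_zeta_nonneg (n : ℕ) : 0 ≤ ((ζ : ArithmeticFunction ℝ) * ζ) n := by
  rw [coe_mul_zeta_apply]
  exact Finset.sum_nonneg fun i _ => by rw [natCoe_apply]; positivity

/-- The sum of `d(n) / n` over `1 ≤ n ≤ N`, where `d` is the divisor function. -/
noncomputable def divisorLogSum (N : ℕ) : ℝ := ∑ n ∈ Finset.Ioc 0 N, (invFunction * invFunction) n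

theorem sum_Ioc_inv_eq_harmonic (N : ℕ) :
    ∑ n ∈ Finset.Ioc 0 N, (n : ℝ)⁻¹ = harmonic N := by
  rw [harmonic_eq_sum_Icc]
  push_cast
  rfl

theorem cast_div_bounds (N : ℕ) {n : ℕ} :
    (N : ℝ) / n - 1 ≤ ((N / n : ℕ) : ℝ) ∧ ((N / n : ℕ) : ℝ) ≤ (N : ℝ) / n := by
  refine ⟨?_, Nat.cast_div_le⟩
  rw [← Nat.floor_div_eq_div (K := ℝ)]
  linarith [Nat.lt_floor_add_one ((N : ℝ) / n)]

theorem sum_zeta_mul_zeta_le (N : ℕ) :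
    ∑ n ∈ Finset.Ioc 0 N, ((ζ : ArithmeticFunction ℝ) * ζ) n ≤ N * (harmonic N : ℝ) := by
  rw [sum_Ioc_mul_zeta_eq_sum, ← sum_Ioc_inv_eq_harmonic, Finset.mul_sum]
  refine Finset.sum_le_sum fun n hn => ?_
  have : n ≠ 0 := by simp at hn; omega
  rw [natCoe_apply, zeta_apply_ne this, Nat.cast_one, one_mul]
  exact (cast_div_bounds N).2

theorem sum_zeta_pow_three_le (N : ℕ) :
    ∑ n ∈ Finset.Ioc 0 N, ((ζ : ArithmeticFunction ℝ) * ζ * ζ) n ≤ N * divisorLogSum N := by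
  rw [sum_Ioc_mul_zeta_eq_sum, divisorLogSum, Finset.mul_sum]
  refine Finset.sum_le_sum fun n hn => ?_
  rw [invFunction_mul_invFunction_apply]
  calc _ ≤ ((ζ : ArithmeticFunction ℝ) * ζ) n * ((N : ℝ) / n) :=
        mul_le_mul_of_nonneg_left (cast_div_bounds N).2 (zeta_mul_zeta_nonneg n)
    _ = _ := by ring

theorem le_sum_zeta_pow_three (N : ℕ) :
    N * divisorLogSum N - N * (harmonic N : ℝ) ≤
      ∑ n ∈ Finset.Ioc 0 N, ((ζ : ArithmeticFunction ℝ) * ζ * ζ) n := by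
  have h := sum_zeta_mul_zeta_le N
  suffices N * divisorLogSum N - ∑ n ∈ Finset.Ioc 0 N, ((ζ : ArithmeticFunction ℝ) * ζ) n ≤
      ∑ n ∈ Finset.Ioc 0 N, ((ζ : ArithmeticFunction ℝ) * ζ * ζ) n by linarith
  rw [sum_Ioc_mul_zeta_eq_sum (R := ℝ) (↑ζ * ↑ζ) N, divisorLogSum, Finset.mul_sum, ← Finset.sum_sub_distrib]
  refine Finset.sum_le_sum fun n hn => ?_
  rw [invFunction_mul_invFunction_apply]
  calc _ = ((ζ : ArithmeticFunction ℝ) * ζ) n * ((N : ℝ) / n - 1) := by ring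
    _ ≤ _ := mul_le_mul_of_nonneg_left (cast_div_bounds N).1 (zeta_mul_zeta_nonneg n)

theorem invFunction_mul_invFunction_nonneg (n : ℕ) : 0 ≤ (invFunction * invFunction) n := by
  rw [invFunction_mul_invFunction_apply]
  exact div_nonneg (zeta_mul_zeta_nonneg n) (Nat.cast_nonneg n)

theorem divisorLogSum_mono : Monotone divisorLogSum := fun _ _ h =>
  Finset.sum_le_sum_of_subset_of_nonneg (Finset.Ioc_subset_Ioc_right h)
    fun n _ _ => invFunction_mul_invFunction_nonneg n

/-- For `N / d < n ≤ N` the weight `1 / n` is at most `d / N`, and the divisor sum up to `N` is at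
most `N` times the harmonic number. -/
theorem divisorLogSum_sub_le (N : ℕ) {d : ℕ} (hd : d ≠ 0) :
    divisorLogSum N - divisorLogSum (N / d) ≤ d * (harmonic N : ℝ) := by
  rcases Nat.eq_zero_or_pos N with rfl | hN
  · simp [divisorLogSum]
  have hN' : (0 : ℝ) < N := by exact_mod_cast hN
  have hsub : Finset.Ioc 0 (N / d) ⊆ Finset.Ioc 0 N :=
    Finset.Ioc_subset_Ioc_right (Nat.div_le_self N d)
  rw [divisorLogSum, divisorLogSum, ← Finset.sum_sdiff hsub, add_sub_cancel_right]
  calc ∑ n ∈ Finset.Ioc 0 N \ Finset.Ioc 0 (N / d), (invFunction * invFunction) n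
      ≤ ∑ n ∈ Finset.Ioc 0 N \ Finset.Ioc 0 (N / d),
          (d / N : ℝ) * ((ζ : ArithmeticFunction ℝ) * ζ) n := by
        refine Finset.sum_le_sum fun n hn => ?_
        simp only [Finset.mem_sdiff, Finset.mem_Ioc, not_and, not_le] at hn
        have h1 : N < n * d := (Nat.div_lt_iff_lt_mul (Nat.pos_of_ne_zero hd)).1 (hn.2 hn.1.1)
        have hn0 : (0 : ℝ) < n := by exact_mod_cast hn.1.1
        rw [invFunction_mul_invFunction_apply, div_eq_inv_mul]
        refine mul_le_mul_of_nonneg_right ?_ (zeta_mul_zeta_nonneg n)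
        rw [le_div_iff₀ hN', inv_mul_le_iff₀ hn0]
        exact_mod_cast h1.le
    _ ≤ ∑ n ∈ Finset.Ioc 0 N, (d / N : ℝ) * ((ζ : ArithmeticFunction ℝ) * ζ) n :=
        Finset.sum_le_sum_of_subset_of_nonneg Finset.sdiff_subset
          fun n _ _ => mul_nonneg (by positivity) (zeta_mul_zeta_nonneg n)
    _ ≤ (d / N : ℝ) * (N * (harmonic N : ℝ)) := by
        rw [← Finset.mul_sum]
        exact mul_le_mul_of_nonneg_left (sum_zeta_mul_zeta_le N) (by positivity)
    _ = d * (harmonic N : ℝ) := by field_simp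

/-- Pairs with both entries at most `√N` have product at most `N`, so the square of the harmonic
number at `√N` is a lower bound. -/
theorem le_divisorLogSum {N : ℕ} (hN : N ≠ 0) : Real.log N ^ 2 / 4 ≤ divisorLogSum N := by
  have hlog : 0 ≤ Real.log N := Real.log_natCast_nonneg N
  have h1 : Real.log N / 2 ≤ (harmonic N.sqrt : ℝ) := by
    refine le_trans ?_ (log_add_one_le_harmonic N.sqrt)
    have : Real.log N ≤ Real.log (((N.sqrt + 1 : ℕ) : ℝ) ^ 2) := by
      apply Real.log_le_log (by positivity)
      have := (Nat.lt_succ_sqrt' N).le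
      exact_mod_cast this
    rw [Real.log_pow] at this
    push_cast at this ⊢
    linarith
  calc Real.log N ^ 2 / 4 = (Real.log N / 2) * (Real.log N / 2) := by ring
    _ ≤ (harmonic N.sqrt : ℝ) * (harmonic N.sqrt : ℝ) :=
        mul_self_le_mul_self (by positivity) h1
    _ = ∑ x ∈ Finset.Ioc 0 N.sqrt ×ˢ Finset.Ioc 0 N.sqrt, invFunction x.1 * invFunction x.2 := by
        rw [← sum_Ioc_inv_eq_harmonic, Finset.sum_mul_sum, ← Finset.sum_product']
        rfl
    _ ≤ divisorLogSum N := by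
        rw [divisorLogSum, sum_Ioc_mul_eq_sum_prod_filter]
        refine Finset.sum_le_sum_of_subset_of_nonneg ?_ fun x _ _ => ?_
        · intro x hx
          simp only [Finset.mem_product, Finset.mem_Ioc, Finset.mem_filter] at hx ⊢
          have h2 := Nat.sqrt_le_self N
          exact ⟨⟨⟨hx.1.1, hx.1.2.trans h2⟩, ⟨hx.2.1, hx.2.2.trans h2⟩⟩,
            (Nat.mul_le_mul hx.1.2 hx.2.2).trans (Nat.sqrt_le N)⟩
        · rw [invFunction_apply, invFunction_apply]
          positivity

theorem tendsto_harmonic_div_divisorLogSum :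
    Tendsto (fun N : ℕ => (harmonic N : ℝ) / divisorLogSum N) atTop (𝓝 0) := by
  have hlog : Tendsto (fun N : ℕ => Real.log N) atTop atTop :=
    Real.tendsto_log_atTop.comp tendsto_natCast_atTop_atTop
  have h1 : Tendsto (fun N : ℕ => 8 / Real.log N) atTop (𝓝 0) :=
    tendsto_const_nhds.div_atTop hlog
  refine squeeze_zero' ?_ ?_ h1
  · filter_upwards [eventually_ne_atTop 0] with N hN
    refine div_nonneg ?_ ((by positivity : (0 : ℝ) ≤ Real.log N ^ 2 / 4).trans (le_divisorLogSum hN))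
    rw [← sum_Ioc_inv_eq_harmonic]
    positivity
  · filter_upwards [eventually_ne_atTop 0, hlog.eventually_ge_atTop 1] with N hN hN1
    have h2 := le_divisorLogSum hN
    have h3 := harmonic_le_one_add_log N
    have h4 : 0 < Real.log N := by linarith
    rw [div_le_div_iff₀ (lt_of_lt_of_le (by positivity) h2) h4]
    nlinarith

theorem eventually_divisorLogSum_pos : ∀ᶠ N : ℕ in atTop, 0 < divisorLogSum N := by
  filter_upwards [eventually_gt_atTop 1] with N hN
  refine lt_of_lt_of_le ?_ (le_divisorLogSum (by omega))
  have : 0 < Real.log N := Real.log_pos (by exact_mod_cast hN)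
  positivity

theorem tendsto_sum_zeta_pow_three_div :
    Tendsto (fun N : ℕ => (∑ n ∈ Finset.Ioc 0 N, ((ζ : ArithmeticFunction ℝ) * ζ * ζ) n) /
      (N * divisorLogSum N)) atTop (𝓝 1) := by
  have h := tendsto_const_nhds (x := (1 : ℝ)).sub tendsto_harmonic_div_divisorLogSum
  rw [sub_zero] at h
  refine tendsto_of_tendsto_of_tendsto_of_le_of_le' h tendsto_const_nhds ?_ ?_
  · filter_upwards [eventually_divisorLogSum_pos, eventually_gt_atTop 0] with N hT hN
    have hN' : (0 : ℝ) < N := by exact_mod_cast hN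
    rw [le_div_iff₀ (by positivity)]
    refine le_trans (le_of_eq ?_) (le_sum_zeta_pow_three N)
    field_simp
  · filter_upwards [eventually_divisorLogSum_pos, eventually_gt_atTop 0] with N hT hN
    have hN' : (0 : ℝ) < N := by exact_mod_cast hN
    exact div_le_one_of_le₀ (sum_zeta_pow_three_le N) (by positivity)

theorem tendsto_divisorLogSum_div {d : ℕ} (hd : d ≠ 0) :
    Tendsto (fun N : ℕ => divisorLogSum (N / d) / divisorLogSum N) atTop (𝓝 1) := by
  have h := tendsto_const_nhds (x := (1 : ℝ)).sub
    (tendsto_harmonic_div_divisorLogSum.const_mul (d : ℝ))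
  rw [mul_zero, sub_zero] at h
  refine tendsto_of_tendsto_of_tendsto_of_le_of_le' h tendsto_const_nhds ?_ ?_
  · filter_upwards [eventually_divisorLogSum_pos] with N hT
    rw [le_div_iff₀ hT, sub_mul, one_mul, mul_assoc, div_mul_cancel₀ _ hT.ne']
    linarith [divisorLogSum_sub_le N hd]
  · filter_upwards [eventually_divisorLogSum_pos] with N hT
    exact div_le_one_of_le₀ (divisorLogSum_mono (Nat.div_le_self N d)) hT.le

theorem tendsto_sum_zeta_pow_three_div_div {d : ℕ} (hd : d ≠ 0) :
    Tendsto (fun N : ℕ => (∑ n ∈ Finset.Ioc 0 (N / d), ((ζ : ArithmeticFunction ℝ) * ζ * ζ) n) /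
      (N * divisorLogSum N)) atTop (𝓝 ((d : ℝ)⁻¹)) := by
  have hdiv : Tendsto (fun N : ℕ => N / d) atTop atTop :=
    tendsto_atTop.2 fun b => by
      filter_upwards [eventually_ge_atTop (b * d)] with N hN
      exact (Nat.le_div_iff_mul_le (Nat.pos_of_ne_zero hd)).2 hN
  have h3 : Tendsto (fun N : ℕ => ((N / d : ℕ) : ℝ) / N) atTop (𝓝 ((d : ℝ)⁻¹)) := by
    have := (tendsto_nat_floor_mul_div_atTop (R := ℝ) (a := (d : ℝ)⁻¹) (by positivity)).comp
      tendsto_natCast_atTop_atTop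
    refine this.congr fun N => ?_
    simp only [Function.comp_apply]
    rw [← div_eq_inv_mul, Nat.floor_div_eq_div]
  have h := ((tendsto_sum_zeta_pow_three_div.comp hdiv).mul (tendsto_divisorLogSum_div hd)).mul h3
  rw [one_mul, one_mul] at h
  refine h.congr' ?_
  filter_upwards [eventually_divisorLogSum_pos, hdiv.eventually eventually_divisorLogSum_pos,
    hdiv.eventually_gt_atTop 0] with N h1 h2 h3
  have h4 : (0 : ℝ) < (N / d : ℕ) := by exact_mod_cast h3
  simp only [Function.comp_apply]
  field_simp

/-- If `∑ |g n| / n` converges, then the summatory function of `g * d₃`, where `d₃` is the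
three-fold divisor function, grows like `∑ g n / n` times that of `d₃`. -/
theorem tendsto_sum_mul_zeta_pow_three (g : ArithmeticFunction ℝ)
    (hg : Summable fun n : ℕ => |g n| / n) :
    Tendsto (fun N : ℕ => (∑ n ∈ Finset.Ioc 0 N, (g * (ζ * ζ * ζ)) n) / (N * divisorLogSum N))
      atTop (𝓝 (∑' n : ℕ, g n / n)) := by
  set D : ℕ → ℝ := fun N => ∑ n ∈ Finset.Ioc 0 N, ((ζ : ArithmeticFunction ℝ) * ζ * ζ) n with hD
  have hD0 : ∀ N, 0 ≤ D N := fun N => Finset.sum_nonneg fun n _ => by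
    rw [coe_mul_zeta_apply]
    exact Finset.sum_nonneg fun i _ => zeta_mul_zeta_nonneg i
  have key : Tendsto (fun N : ℕ => ∑' k : ℕ, g k * (D (N / k) / (N * divisorLogSum N)))
      atTop (𝓝 (∑' n : ℕ, g n / n)) := by
    -- Termwise the quotient tends to `1 / k`; it is also at most `1 / k`, since `D (N / k) ≤ (N /
    -- k) T(N / k)` and `T` is monotone.
    refine tendsto_tsum_of_dominated_convergence hg ?_ ?_
    · intro k
      rcases eq_or_ne k 0 with rfl | hk
      · simp
      · rw [div_eq_mul_inv]
        exact (tendsto_sum_zeta_pow_three_div_div hk).const_mul _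
    · filter_upwards [eventually_divisorLogSum_pos, eventually_gt_atTop 0] with N hT hN k
      have hN' : (0 : ℝ) < N := by exact_mod_cast hN
      rw [norm_mul, Real.norm_eq_abs, div_eq_mul_inv |g k|]
      refine mul_le_mul_of_nonneg_left ?_ (abs_nonneg _)
      rw [Real.norm_of_nonneg (div_nonneg (hD0 _) (by positivity)), div_le_iff₀ (by positivity)]
      calc D (N / k) ≤ (N / k : ℕ) * divisorLogSum (N / k) := sum_zeta_pow_three_le _
        _ ≤ (N / k : ℝ) * divisorLogSum N :=
          mul_le_mul (cast_div_bounds N).2 (divisorLogSum_mono (Nat.div_le_self N k))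
            (Finset.sum_nonneg fun n _ => invFunction_mul_invFunction_nonneg n) (by positivity)
        _ = _ := by ring
  refine key.congr fun N => ?_
  rw [sum_Ioc_mul_eq_sum_sum, Finset.sum_div, tsum_eq_sum (s := Finset.Ioc 0 N)]
  · refine Finset.sum_congr rfl fun n _ => ?_
    rw [mul_div_assoc]
  · intro k hk
    rcases eq_or_ne k 0 with rfl | hk0
    · simp
    · have : N / k = 0 := Nat.div_eq_of_lt (by simp at hk; omega)
      simp [this, hD]

/-! ### Absolute convergence and Euler products -/

theorem ArithmeticFunction.IsMultiplicative.div_natCast_mul {f : ArithmeticFunction ℝ}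
    (hf : f.IsMultiplicative) {m n : ℕ} (h : Nat.Coprime m n) :
    f (m * n) / (m * n : ℕ) = f m / m * (f n / n) := by
  rw [hf.map_mul_of_coprime h, Nat.cast_mul, mul_div_mul_comm]

theorem summable_of_prime_pow_succ_le {u : ℕ → ℝ} {B : ℝ}
    (h : ∀ e, |u (e + 1)| ≤ B * (2 / 3) ^ e) : Summable fun e => |u e| :=
  (summable_nat_add_iff 1).1 (Summable.of_nonneg_of_le (fun _ => abs_nonneg _) h
    ((summable_geometric_of_lt_one (by norm_num) (by norm_num)).mul_left B))

theorem tsum_abs_le_of_prime_pow_succ_le {u : ℕ → ℝ} {B : ℝ}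
    (h : ∀ e, |u (e + 1)| ≤ B * (2 / 3) ^ e) : ∑' e, |u e| ≤ |u 0| + 3 * B := by
  rw [(summable_of_prime_pow_succ_le h).tsum_eq_zero_add]
  have hgeo : Summable fun e : ℕ => B * (2 / 3 : ℝ) ^ e :=
    (summable_geometric_of_lt_one (by norm_num) (by norm_num)).mul_left B
  have := Summable.tsum_le_tsum h ((summable_nat_add_iff 1).2 (summable_of_prime_pow_succ_le h)) hgeo
  rw [tsum_mul_left, tsum_geometric_of_lt_one (by norm_num) (by norm_num)] at this
  norm_num at this
  linarith

/-- A criterion for the convergence of `∑ |f n| / n` in terms of the values at prime powers. -/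
theorem summable_abs_div_of_prime_pow_le {f : ArithmeticFunction ℝ} (hf : f.IsMultiplicative)
    {C : ℝ} (hC : 0 ≤ C)
    (h : ∀ p : ℕ, p.Prime → ∀ e : ℕ,
      |f (p ^ (e + 1)) / (p ^ (e + 1) : ℕ)| ≤ C / (p : ℝ) ^ 2 * (2 / 3) ^ e) :
    Summable fun n : ℕ => |f n / n| := by
  have hsumsq : Summable fun n : ℕ => 3 * C / (n : ℝ) ^ 2 := by
    simpa [div_eq_mul_inv] using (Real.summable_nat_pow_inv.2 one_lt_two).mul_left (3 * C)
  -- Partial sums are bounded by a finite Euler product over primes below `N`, each factor being at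
  -- most `1 + 3C/p² ≤ exp(3C/p²)`.
  refine summable_of_sum_range_le (c := Real.exp (∑' n : ℕ, 3 * C / (n : ℝ) ^ 2))
    (fun _ => abs_nonneg _) fun N => ?_
  have h1 : |f 1 / (1 : ℕ)| = 1 := by simp [hf.1]
  have hmul : ∀ {m n : ℕ}, Nat.Coprime m n →
      |f (m * n) / (m * n : ℕ)| = |f m / m| * |f n / n| := fun hmn => by
    rw [hf.div_natCast_mul hmn, abs_mul]
  obtain ⟨hs, ht⟩ := EulerProduct.summable_and_hasSum_smoothNumbers_prod_primesBelow_tsum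
    (f := fun n : ℕ => |f n / n|) h1 hmul
    (fun {p} hp => by
      simpa only [Real.norm_eq_abs, abs_abs] using
        summable_of_prime_pow_succ_le (u := fun e => f (p ^ e) / (p ^ e : ℕ)) (h p hp)) N
  simp only [Real.norm_eq_abs, abs_abs] at hs
  calc ∑ n ∈ Finset.range N, |f n / n|
      = ∑ n ∈ Finset.range N, (N.smoothNumbers).indicator (fun n : ℕ => |f n / n|) n := by
        refine Finset.sum_congr rfl fun n hn => ?_
        rcases Nat.eq_zero_or_pos n with rfl | hn0
        · simp [Set.indicator]
        · rw [Set.indicator_of_mem]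
          exact Nat.mem_smoothNumbers_of_lt hn0 (Finset.mem_range.1 hn)
    _ ≤ ∑' n, (N.smoothNumbers).indicator (fun n : ℕ => |f n / n|) n :=
        Summable.sum_le_tsum _ (fun n _ => Set.indicator_nonneg (fun _ _ => abs_nonneg _) n)
          (summable_subtype_iff_indicator.1 hs)
    _ = ∏ p ∈ N.primesBelow, ∑' e : ℕ, |f (p ^ e) / (p ^ e : ℕ)| := by
        rw [← tsum_subtype, ht.tsum_eq]
    _ ≤ ∏ p ∈ N.primesBelow, Real.exp (3 * C / (p : ℝ) ^ 2) := by
        refine Finset.prod_le_prod (fun p _ => tsum_nonneg fun _ => abs_nonneg _) fun p hp => ?_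
        have := tsum_abs_le_of_prime_pow_succ_le (u := fun e => f (p ^ e) / (p ^ e : ℕ))
          (h p (Nat.prime_of_mem_primesBelow hp))
        simp only [pow_zero, h1] at this
        refine this.trans (le_trans (le_of_eq ?_) (Real.add_one_le_exp _))
        ring
    _ = Real.exp (∑ p ∈ N.primesBelow, 3 * C / (p : ℝ) ^ 2) := (Real.exp_sum _ _).symm
    _ ≤ Real.exp (∑' n : ℕ, 3 * C / (n : ℝ) ^ 2) :=
        Real.exp_le_exp.2 (hsumsq.sum_le_tsum _ fun n _ => by positivity)

theorem hasProd_tsum_prime_pow_div {f : ArithmeticFunction ℝ} (hf : f.IsMultiplicative)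
    (h : Summable fun n : ℕ => |f n / n|) :
    HasProd (fun p : Nat.Primes => ∑' e : ℕ, f (p ^ e) / ((p : ℕ) ^ e : ℕ)) (∑' n : ℕ, f n / n) :=
  EulerProduct.eulerProduct_hasProd (f := fun n : ℕ => f n / n) (by simp [hf.1])
    (fun h => hf.div_natCast_mul h) h (by simp)

/-! ### Removing three zeta factors -/

theorem mul_moebius_prime_pow_succ (f : ArithmeticFunction ℝ) {p : ℕ} (hp : p.Prime) (e : ℕ) :
    (f * (μ : ArithmeticFunction ℝ)) (p ^ (e + 1)) = f (p ^ (e + 1)) - f (p ^ e) := by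
  have key : ∀ k, f (p ^ k) = ∑ i ∈ Finset.range (k + 1), (f * (μ : ArithmeticFunction ℝ)) (p ^ i) := by
    intro k
    rw [← Nat.sum_divisors_prime_pow hp, ← coe_mul_zeta_apply, mul_assoc, coe_moebius_mul_coe_zeta,
      mul_one]
  rw [key (e + 1), key e, Finset.sum_range_succ, add_sub_cancel_left]

theorem mul_moebius_one (f : ArithmeticFunction ℝ) :
    (f * (μ : ArithmeticFunction ℝ)) 1 = f 1 := by
  simp

/-- The arithmetic function `f * μ * μ * μ`. -/
noncomputable def moebiusCubed (f : ArithmeticFunction ℝ) : ArithmeticFunction ℝ :=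
  f * (μ : ArithmeticFunction ℝ) * (μ : ArithmeticFunction ℝ) * (μ : ArithmeticFunction ℝ)

theorem isMultiplicative_moebiusCubed {f : ArithmeticFunction ℝ} (hf : f.IsMultiplicative) :
    (moebiusCubed f).IsMultiplicative :=
  ((hf.mul isMultiplicative_moebius.intCast).mul isMultiplicative_moebius.intCast).mul
    isMultiplicative_moebius.intCast

theorem moebiusCubed_mul_zeta_pow_three (f : ArithmeticFunction ℝ) :
    moebiusCubed f * (ζ * ζ * ζ) = f := by
  have h : (μ : ArithmeticFunction ℝ) * ζ = 1 := coe_moebius_mul_coe_zeta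
  calc moebiusCubed f * (ζ * ζ * ζ)
      = f * ((μ : ArithmeticFunction ℝ) * ζ) * ((μ : ArithmeticFunction ℝ) * ζ) *
          ((μ : ArithmeticFunction ℝ) * ζ) := by
        rw [moebiusCubed]; ring
    _ = f := by rw [h, mul_one, mul_one, mul_one]

theorem moebiusCubed_prime (f : ArithmeticFunction ℝ) {p : ℕ} (hp : p.Prime) :
    moebiusCubed f p = f p - 3 * f 1 := by
  have h := mul_moebius_prime_pow_succ (e := 0) (hp := hp)
  simp only [zero_add, pow_one, pow_zero] at h
  simp only [moebiusCubed, h, mul_moebius_one]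
  ring

theorem moebiusCubed_prime_sq (f : ArithmeticFunction ℝ) {p : ℕ} (hp : p.Prime) :
    moebiusCubed f (p ^ 2) = f (p ^ 2) - 3 * f p + 3 * f 1 := by
  have h := mul_moebius_prime_pow_succ (e := 0) (hp := hp)
  have h2 := mul_moebius_prime_pow_succ (e := 1) (hp := hp)
  simp only [zero_add, pow_one, pow_zero, one_add_one_eq_two] at h h2
  simp only [moebiusCubed, h, h2, mul_moebius_one]
  ring

/-- Convolving with `μ` is a backward difference in the exponent, so three of them give the third
difference. -/
theorem moebiusCubed_prime_pow (f : ArithmeticFunction ℝ) {p : ℕ} (hp : p.Prime) (e : ℕ) :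
    moebiusCubed f (p ^ (e + 3)) =
      f (p ^ (e + 3)) - 3 * f (p ^ (e + 2)) + 3 * f (p ^ (e + 1)) - f (p ^ e) := by
  have h := fun f e => mul_moebius_prime_pow_succ f hp e
  simp only [moebiusCubed, h]
  ring

/-! ### Local factors for cocyclic and for all subrings -/

section cocyclic

variable {p : ℕ} (hp : p.Prime)

include hp

theorem moebiusCubed_cocyclicCount_prime : moebiusCubed cocyclicCount p = 0 := by
  have := cocyclicCount_prime_pow hp 0
  rw [zero_add, pow_one] at this
  rw [moebiusCubed_prime _ hp, this, isMultiplicative_cocyclicCount.1]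
  norm_num

theorem moebiusCubed_cocyclicCount_prime_sq : moebiusCubed cocyclicCount (p ^ 2) = -3 := by
  have h1 := cocyclicCount_prime_pow hp 0
  have h2 := cocyclicCount_prime_pow hp 1
  rw [zero_add, pow_one] at h1
  rw [one_add_one_eq_two] at h2
  rw [moebiusCubed_prime_sq _ hp, h1, h2, isMultiplicative_cocyclicCount.1]
  norm_num

theorem moebiusCubed_cocyclicCount_prime_cube : moebiusCubed cocyclicCount (p ^ 3) = 2 := by
  have := moebiusCubed_prime_pow cocyclicCount hp 0
  rw [cocyclicCount_prime_pow hp, cocyclicCount_prime_pow hp, cocyclicCount_prime_pow hp, pow_zero,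
    isMultiplicative_cocyclicCount.1, zero_add] at this
  rw [this]
  norm_num

theorem moebiusCubed_cocyclicCount_prime_pow (e : ℕ) :
    moebiusCubed cocyclicCount (p ^ (e + 4)) = 0 := by
  have := moebiusCubed_prime_pow cocyclicCount hp (e + 1)
  rw [cocyclicCount_prime_pow hp, cocyclicCount_prime_pow hp, cocyclicCount_prime_pow hp,
    cocyclicCount_prime_pow hp] at this
  rw [show e + 4 = e + 1 + 3 by rfl, this]
  norm_num

theorem abs_moebiusCubed_cocyclicCount_div_le (e : ℕ) :
    |moebiusCubed cocyclicCount (p ^ (e + 1)) / (p ^ (e + 1) : ℕ)| ≤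
      5 / (p : ℝ) ^ 2 * (2 / 3) ^ e := by
  have hp2 : (2 : ℝ) ≤ p := by exact_mod_cast hp.two_le
  rcases e with _ | _ | _ | e
  · rw [zero_add, pow_one, moebiusCubed_cocyclicCount_prime hp, zero_div, abs_zero]
    positivity
  · rw [zero_add, one_add_one_eq_two, moebiusCubed_cocyclicCount_prime_sq hp, abs_div]
    push_cast
    rw [abs_of_pos (by positivity : (0 : ℝ) < (p : ℝ) ^ 2), div_mul_eq_mul_div]
    gcongr
    norm_num
  · rw [show 0 + 1 + 1 + 1 = 3 from rfl, moebiusCubed_cocyclicCount_prime_cube hp, abs_div]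
    push_cast
    rw [abs_of_pos (by positivity : (0 : ℝ) < (p : ℝ) ^ 3), abs_of_pos (by norm_num),
      div_mul_eq_mul_div]
    gcongr
    · norm_num
    · linarith
    · norm_num
  · rw [show e + 1 + 1 + 1 + 1 = e + 4 from rfl, moebiusCubed_cocyclicCount_prime_pow hp, zero_div,
      abs_zero]
    positivity

theorem tsum_moebiusCubed_cocyclicCount_div :
    ∑' e : ℕ, moebiusCubed cocyclicCount (p ^ e) / (p ^ e : ℕ) =
      (p : ℝ) ^ (-3 : ℤ) * ((p : ℝ) - 1) ^ 2 * ((p : ℝ) + 2) := by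
  have hp0 : (p : ℝ) ≠ 0 := by exact_mod_cast hp.ne_zero
  have h1 := (isMultiplicative_moebiusCubed isMultiplicative_cocyclicCount).1
  rw [tsum_eq_sum (s := Finset.range 4)]
  · simp only [Finset.sum_range_succ, Finset.sum_range_zero, pow_zero, pow_one, h1,
      moebiusCubed_cocyclicCount_prime hp, moebiusCubed_cocyclicCount_prime_sq hp,
      moebiusCubed_cocyclicCount_prime_cube hp]
    have h3 : (p : ℝ) ^ (-3 : ℤ) = ((p : ℝ) ^ 3)⁻¹ := by rw [zpow_neg]; norm_cast
    rw [h3]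
    push_cast
    field_simp
    ring
  · intro e he
    obtain ⟨k, rfl⟩ := Nat.exists_eq_add_of_le' (by simpa using he : 4 ≤ e)
    rw [moebiusCubed_cocyclicCount_prime_pow hp, zero_div]

end cocyclic

section all

variable {p : ℕ} (hp : p.Prime)

include hp

theorem moebiusCubed_subringCount_prime : moebiusCubed subringCount p = 0 := by
  rw [moebiusCubed_prime _ hp, subringCount_prime hp, isMultiplicative_subringCount.1]
  norm_num

theorem moebiusCubed_subringCount_prime_sq : moebiusCubed subringCount (p ^ 2) = -2 := by
  rw [moebiusCubed_prime_sq _ hp, subringCount_prime hp, subringCount_prime_sq hp,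
    isMultiplicative_subringCount.1]
  norm_num

theorem moebiusCubed_subringCount_prime_cube : moebiusCubed subringCount (p ^ 3) = p := by
  have h := moebiusCubed_prime_pow subringCount hp 0
  rw [zero_add, zero_add, zero_add, pow_zero, pow_one, subringCount_prime hp,
    subringCount_prime_sq hp, isMultiplicative_subringCount.1] at h
  have h3 := subringCount_prime_pow_add_three hp 0
  rw [zero_add, pow_zero, isMultiplicative_subringCount.1] at h3
  rw [h, h3]
  ring

theorem moebiusCubed_subringCount_prime_pow_four : moebiusCubed subringCount (p ^ 4) = 1 := by
  have h := moebiusCubed_prime_pow subringCount hp 1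
  have h3 := subringCount_prime_pow_add_three hp 0
  have h4 := subringCount_prime_pow_add_three hp 1
  norm_num [subringCount_prime hp, subringCount_prime_sq hp, isMultiplicative_subringCount.1]
    at h h3 h4
  rw [h, h3, h4]
  ring

theorem moebiusCubed_subringCount_prime_pow (e : ℕ) :
    moebiusCubed subringCount (p ^ (e + 5)) = p * moebiusCubed subringCount (p ^ (e + 2)) := by
  have h3 := fun e => subringCount_prime_pow_add_three hp e
  rcases e with _ | e
  · have h := moebiusCubed_prime_pow subringCount hp 2
    have h30 := h3 0
    have h31 := h3 1
    have h32 := h3 2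
    rw [zero_add, zero_add, moebiusCubed_subringCount_prime_sq hp]
    norm_num [subringCount_prime hp, subringCount_prime_sq hp, isMultiplicative_subringCount.1]
      at h h30 h31 h32
    rw [h, h30, h31, h32]
    ring
  · rw [show e + 1 + 5 = e + 3 + 3 from rfl, show e + 1 + 2 = e + 3 from rfl,
      moebiusCubed_prime_pow _ hp, moebiusCubed_prime_pow _ hp, h3,
      show e + 3 + 2 = e + 2 + 3 from rfl, show e + 3 + 1 = e + 1 + 3 from rfl, h3 (e + 2),
      h3 (e + 1)]
    linear_combination -h3 e

theorem moebiusCubed_subringCount_div_prime_pow (e : ℕ) :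
    moebiusCubed subringCount (p ^ (e + 5)) / (p ^ (e + 5) : ℕ) =
      ((p : ℝ) ^ 2)⁻¹ * (moebiusCubed subringCount (p ^ (e + 2)) / (p ^ (e + 2) : ℕ)) := by
  have hp0 : (p : ℝ) ≠ 0 := by exact_mod_cast hp.ne_zero
  rw [moebiusCubed_subringCount_prime_pow hp]
  push_cast
  field_simp
  ring

/-- Three steps in the exponent cost a factor `p⁻² ≤ 1/4 ≤ 8/27 = (2/3)³`, which is why the ratio
`2/3` works. The constant `5` is shared with the cocyclic bound, where `p ^ 2` requires `3 ≤ 5 ·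
2/3`. -/
theorem abs_moebiusCubed_subringCount_div_le (e : ℕ) :
    |moebiusCubed subringCount (p ^ (e + 1)) / (p ^ (e + 1) : ℕ)| ≤
      5 / (p : ℝ) ^ 2 * (2 / 3) ^ e := by
  have hp2 : (2 : ℝ) ≤ p := by exact_mod_cast hp.two_le
  have hinv : ((p : ℝ) ^ 2)⁻¹ ≤ 1 / 4 := by
    rw [inv_le_comm₀ (by positivity) (by norm_num)]
    nlinarith
  induction e using Nat.strong_induction_on with
  | _ e ih =>
    rcases e with _ | _ | _ | _ | e
    · rw [zero_add, pow_one, moebiusCubed_subringCount_prime hp, zero_div, abs_zero]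
      positivity
    · rw [zero_add, one_add_one_eq_two, moebiusCubed_subringCount_prime_sq hp, abs_div]
      push_cast
      rw [abs_of_pos (by positivity : (0 : ℝ) < (p : ℝ) ^ 2), div_mul_eq_mul_div]
      gcongr
      norm_num
    · rw [show 0 + 1 + 1 + 1 = 3 from rfl, moebiusCubed_subringCount_prime_cube hp,
        abs_of_nonneg (by positivity)]
      have : (p : ℝ) / (p ^ 3 : ℕ) = 1 / (p : ℝ) ^ 2 := by push_cast; field_simp
      rw [this, div_mul_eq_mul_div]
      gcongr
      norm_num
    · rw [show 0 + 1 + 1 + 1 + 1 = 4 from rfl, moebiusCubed_subringCount_prime_pow_four hp,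
        abs_of_nonneg (by positivity)]
      push_cast
      rw [div_mul_eq_mul_div]
      gcongr
      · norm_num
      · linarith
      · norm_num
    · rw [show e + 1 + 1 + 1 + 1 + 1 = e + 5 from rfl, moebiusCubed_subringCount_div_prime_pow hp,
        abs_mul, abs_of_pos (by positivity : 0 < ((p : ℝ) ^ 2)⁻¹)]
      have h1 := ih (e + 1) (by omega)
      rw [show e + 1 + 1 = e + 2 from rfl] at h1
      calc _ ≤ (8 / 27 : ℝ) * (5 / (p : ℝ) ^ 2 * (2 / 3) ^ (e + 1)) := by
            gcongr
            linarith
        _ = _ := by ring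

theorem tsum_moebiusCubed_subringCount_div :
    ∑' e : ℕ, moebiusCubed subringCount (p ^ e) / (p ^ e : ℕ) = 1 - ((p : ℝ) ^ 2)⁻¹ := by
  have hp2 : (2 : ℝ) ≤ p := by exact_mod_cast hp.two_le
  have h1 := (isMultiplicative_moebiusCubed isMultiplicative_subringCount).1
  have hs : Summable fun e : ℕ => moebiusCubed subringCount (p ^ e) / (p ^ e : ℕ) :=
    (summable_of_prime_pow_succ_le
      (u := fun e : ℕ => moebiusCubed subringCount (p ^ e) / (p ^ e : ℕ))
      (abs_moebiusCubed_subringCount_div_le hp)).of_abs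
  have e2 := hs.sum_add_tsum_nat_add 2
  have e5 := hs.sum_add_tsum_nat_add 5
  simp only [moebiusCubed_subringCount_div_prime_pow hp] at e5
  rw [tsum_mul_left] at e5
  set S := ∑' e : ℕ, moebiusCubed subringCount (p ^ e) / (p ^ e : ℕ)
  set S' := ∑' e : ℕ, moebiusCubed subringCount (p ^ (e + 2)) / (p ^ (e + 2) : ℕ)
  simp only [Finset.sum_range_succ, Finset.sum_range_zero, pow_zero, pow_one, h1,
      moebiusCubed_subringCount_prime hp, moebiusCubed_subringCount_prime_sq hp,
      moebiusCubed_subringCount_prime_cube hp, moebiusCubed_subringCount_prime_pow_four hp]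
    at e2 e5
  have hp0 : (p : ℝ) ≠ 0 := by positivity
  set x := ((p : ℝ) ^ 2)⁻¹ with hx
  have hx1 : x < 1 := inv_lt_one_of_one_lt₀ (by nlinarith)
  have k3 : (p : ℝ) / (p ^ 3 : ℕ) = x := by rw [hx]; push_cast; field_simp
  have k2 : (-2 : ℝ) / (p ^ 2 : ℕ) = -2 * x := by rw [hx]; push_cast; rfl
  have k4 : (1 : ℝ) / (p ^ 4 : ℕ) = x ^ 2 := by rw [hx]; push_cast; field_simp
  rw [k2, k3, k4] at e5
  norm_num at e2 e5
  -- Eliminate the tail `S'` between `S = 1 + S'` and `S = 1 - 2x + x + x² + x S'`.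
  have : (1 - x) * S = (1 - x) * (1 - x) := by
    clear_value x S S'
    linear_combination x * e2 - e5
  exact mul_left_cancel₀ (by linarith) this

end all

/-! ### The global densities as Euler products -/

theorem summable_moebiusCubed_cocyclicCount :
    Summable fun n : ℕ => |moebiusCubed cocyclicCount n / n| :=
  summable_abs_div_of_prime_pow_le (isMultiplicative_moebiusCubed isMultiplicative_cocyclicCount)
    (by norm_num) fun _ hp => abs_moebiusCubed_cocyclicCount_div_le hp

theorem summable_moebiusCubed_subringCount :
    Summable fun n : ℕ => |moebiusCubed subringCount n / n| :=
  summable_abs_div_of_prime_pow_le (isMultiplicative_moebiusCubed isMultiplicative_subringCount)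
    (by norm_num) fun _ hp => abs_moebiusCubed_subringCount_div_le hp

theorem hasProd_cocyclic :
    HasProd (fun p : Nat.Primes => (p : ℝ) ^ (-3 : ℤ) * ((p : ℝ) - 1) ^ 2 * ((p : ℝ) + 2))
      (∑' n : ℕ, moebiusCubed cocyclicCount n / n) := by
  have h := hasProd_tsum_prime_pow_div
    (isMultiplicative_moebiusCubed isMultiplicative_cocyclicCount)
    summable_moebiusCubed_cocyclicCount
  exact h.congr_fun fun p => (tsum_moebiusCubed_cocyclicCount_div p.2).symm

theorem hasProd_subring :
    HasProd (fun p : Nat.Primes => 1 - ((p : ℝ) ^ 2)⁻¹)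
      (∑' n : ℕ, moebiusCubed subringCount n / n) := by
  have h := hasProd_tsum_prime_pow_div
    (isMultiplicative_moebiusCubed isMultiplicative_subringCount)
    summable_moebiusCubed_subringCount
  exact h.congr_fun fun p => (tsum_moebiusCubed_subringCount_div p.2).symm

theorem hasProd_riemannZeta_two_re :
    HasProd (fun p : Nat.Primes => (1 - ((p : ℝ) ^ 2)⁻¹)⁻¹) (riemannZeta 2).re := by
  have h := riemannZeta_eulerProduct_hasProd (s := 2) (by norm_num)
  have h2 : riemannZeta 2 = ((riemannZeta 2).re : ℂ) := by
    rw [riemannZeta_two]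
    norm_cast
  have h3 : (fun p : Nat.Primes => (1 - (p : ℂ) ^ (-2 : ℂ))⁻¹) =
      fun p : Nat.Primes => (((1 - ((p : ℝ) ^ 2)⁻¹)⁻¹ : ℝ) : ℂ) := by
    funext p
    rw [Complex.cpow_neg, Complex.cpow_ofNat]
    push_cast
    rfl
  rw [h2, h3] at h
  rw [HasProd] at h ⊢
  refine tendsto_ofReal_iff.1 (h.congr fun s => ?_)
  push_cast
  rfl

theorem riemannZeta_two_re : (riemannZeta 2).re = Real.pi ^ 2 / 6 := by
  rw [riemannZeta_two]
  norm_cast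

theorem one_sub_inv_sq_ne_zero (p : Nat.Primes) : 1 - ((p : ℝ) ^ 2)⁻¹ ≠ 0 := by
  have hp2 : (2 : ℝ) ≤ p := by exact_mod_cast p.2.two_le
  have : ((p : ℝ) ^ 2)⁻¹ < 1 := inv_lt_one_of_one_lt₀ (by nlinarith)
  linarith

theorem riemannZeta_two_mul_tsum_subring :
    (riemannZeta 2).re * ∑' n : ℕ, moebiusCubed subringCount n / n = 1 := by
  have h := hasProd_riemannZeta_two_re.mul hasProd_subring
  have h1 : (fun p : Nat.Primes => (1 - ((p : ℝ) ^ 2)⁻¹)⁻¹ * (1 - ((p : ℝ) ^ 2)⁻¹)) =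
      fun _ => 1 := funext fun p => inv_mul_cancel₀ (one_sub_inv_sq_ne_zero p)
  rw [h1] at h
  exact h.unique hasProd_one

/-! ### Numerical evaluation -/

/-- The factor `(1 - 1/p)² (1 + 2/p) / (1 - 1/p²)³`. -/
noncomputable def acceleratedFactor (n : ℕ) : ℝ :=
  if n.Prime then (n : ℝ) ^ 3 * (n + 2) / ((n - 1) * (n + 1) ^ 3) else 1

theorem hasProd_acceleratedFactor {E : ℝ}
    (hE : HasProd (fun p : Nat.Primes =>
      (p : ℝ) ^ (-3 : ℤ) * ((p : ℝ) - 1) ^ 2 * ((p : ℝ) + 2)) E) :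
    HasProd acceleratedFactor (E * (riemannZeta 2).re ^ 3) := by
  have hz := hasProd_riemannZeta_two_re
  have h := hE.mul ((hz.mul hz).mul hz)
  rw [show (riemannZeta 2).re * (riemannZeta 2).re * (riemannZeta 2).re =
    (riemannZeta 2).re ^ 3 by ring] at h
  let F : ℕ → ℝ := fun n => (n : ℝ) ^ 3 * (n + 2) / ((n - 1) * (n + 1) ^ 3)
  have h2 : HasProd (F ∘ Subtype.val (p := (· ∈ {x | Nat.Prime x}))) (E * (riemannZeta 2).re ^ 3) := by
    refine h.congr_fun fun p => ?_
    have hp2 : (2 : ℝ) ≤ p := by exact_mod_cast p.2.two_le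
    have hp0 : (p : ℝ) ≠ 0 := by positivity
    have hp1 : (p : ℝ) - 1 ≠ 0 := by linarith
    have hp3 : (p : ℝ) + 1 ≠ 0 := by positivity
    have h3 : (p : ℝ) ^ (-3 : ℤ) = ((p : ℝ) ^ 3)⁻¹ := by rw [zpow_neg]; norm_cast
    have h4 : 1 - ((p : ℝ) ^ 2)⁻¹ = (p - 1) * (p + 1) / (p : ℝ) ^ 2 := by field_simp; ring
    rw [h3, h4]
    change (p : ℝ) ^ 3 * (p + 2) / ((p - 1) * (p + 1) ^ 3) = _
    field_simp
  rw [hasProd_subtype_iff_mulIndicator] at h2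
  convert h2 using 1
  funext n
  rw [acceleratedFactor, Set.mulIndicator_apply]
  rfl

theorem one_le_acceleratedFactor (n : ℕ) : 1 ≤ acceleratedFactor n := by
  rw [acceleratedFactor]
  split_ifs with h
  · have hp2 : (2 : ℝ) ≤ n := by exact_mod_cast h.two_le
    have hp1 : 0 < (n : ℝ) - 1 := by linarith
    rw [one_le_div (by positivity)]
    nlinarith
  · exact le_rfl

theorem acceleratedFactor_le {n : ℕ} (hn : 2 ≤ n) : acceleratedFactor n ≤ 1 + 2 / (n : ℝ) ^ 3 := by
  have hp2 : (2 : ℝ) ≤ n := by exact_mod_cast hn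
  rw [acceleratedFactor]
  split_ifs with h
  · have hp1 : 0 < (n : ℝ) - 1 := by linarith
    obtain ⟨t, ht⟩ : ∃ t : ℝ, (n : ℝ) = t + 2 := ⟨n - 2, by ring⟩
    have ht0 : 0 ≤ t := by linarith
    rw [show 1 + 2 / (n : ℝ) ^ 3 = ((n : ℝ) ^ 3 + 2) / (n : ℝ) ^ 3 by field_simp,
      div_le_div_iff₀ (by positivity) (by positivity), ht, ← sub_nonneg]
    ring_nf
    positivity
  · have : 0 ≤ 2 / (n : ℝ) ^ 3 := by positivity
    linarith

/-- Bounds the factor at an odd integer by a telescoping exponential; after `1 + 2/n³` it reduces to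
`4j(j+1) ≤ (2j+1)²`. Larger even integers contribute nothing, which halves the tail. -/
theorem acceleratedFactor_odd_le {j : ℕ} (hj : 1 ≤ j) :
    acceleratedFactor (2 * j + 1) ≤
      Real.exp ((1 / (2 * j : ℝ) ^ 2 - 1 / (2 * (j + 1) : ℝ) ^ 2) / 2) := by
  have hj' : (1 : ℝ) ≤ j := by exact_mod_cast hj
  refine (acceleratedFactor_le (by omega)).trans ?_
  refine le_trans ?_ (Real.add_one_le_exp _)
  rw [add_comm]
  refine add_le_add ?_ le_rfl
  push_cast
  rw [show (1 / (2 * j : ℝ) ^ 2 - 1 / (2 * (j + 1) : ℝ) ^ 2) / 2 =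
    (2 * j + 1) / (8 * (j : ℝ) ^ 2 * (j + 1) ^ 2) by field_simp; ring,
    div_le_div_iff₀ (by positivity) (by positivity)]
  obtain ⟨t, ht⟩ : ∃ t : ℝ, (j : ℝ) = t + 1 := ⟨j - 1, by ring⟩
  have ht0 : 0 ≤ t := by linarith
  rw [ht, ← sub_nonneg]
  ring_nf
  positivity

theorem acceleratedFactor_even {j : ℕ} (hj : 2 ≤ j) : acceleratedFactor (2 * j) = 1 := by
  rw [acceleratedFactor, if_neg (Nat.not_prime_mul (by norm_num) (by omega))]

theorem prod_acceleratedFactor_le {k : ℕ} (hk : 2 ≤ k) (i : ℕ) :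
    ∏ n ∈ Finset.range (2 * (k + i)), acceleratedFactor n ≤
      (∏ n ∈ Finset.range (2 * k), acceleratedFactor n) *
        Real.exp ((1 / (2 * k : ℝ) ^ 2 - 1 / (2 * (k + i) : ℝ) ^ 2) / 2) := by
  induction i with
  | zero => simp
  | succ i ih =>
    rw [show 2 * (k + (i + 1)) = 2 * (k + i) + 1 + 1 by ring, Finset.prod_range_succ,
      Finset.prod_range_succ, acceleratedFactor_even (by omega), mul_one]
    have h := acceleratedFactor_odd_le (j := k + i) (by omega)
    calc _ ≤ _ := mul_le_mul ih h (zero_le_one.trans (one_le_acceleratedFactor _))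
          (mul_nonneg (Finset.prod_nonneg fun n _ => zero_le_one.trans (one_le_acceleratedFactor n))
            (Real.exp_pos _).le)
      _ = _ := by
          rw [mul_assoc, ← Real.exp_add]
          push_cast
          ring_nf

theorem prod_le_of_hasProd_acceleratedFactor {V : ℝ} (hV : HasProd acceleratedFactor V) (N : ℕ) :
    ∏ n ∈ Finset.range N, acceleratedFactor n ≤ V := by
  have hmono : Monotone fun N => ∏ n ∈ Finset.range N, acceleratedFactor n :=
    monotone_nat_of_le_succ fun n => by
      rw [Finset.prod_range_succ]
      exact le_mul_of_one_le_right
        (Finset.prod_nonneg fun n _ => zero_le_one.trans (one_le_acceleratedFactor n))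
        (one_le_acceleratedFactor n)
  exact hmono.ge_of_tendsto hV.tendsto_prod_nat N

theorem le_prod_of_hasProd_acceleratedFactor {V : ℝ} (hV : HasProd acceleratedFactor V) {k : ℕ}
    (hk : 2 ≤ k) :
    V ≤ (∏ n ∈ Finset.range (2 * k), acceleratedFactor n) * Real.exp (1 / (2 * k : ℝ) ^ 2 / 2) := by
  have h2 : Tendsto (fun i => 2 * (k + i)) atTop atTop :=
    tendsto_atTop_mono (fun i => by omega : ∀ i, i ≤ 2 * (k + i)) tendsto_id
  refine le_of_tendsto' (hV.tendsto_prod_nat.comp h2) fun i => ?_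
  refine (prod_acceleratedFactor_le hk i).trans ?_
  refine mul_le_mul_of_nonneg_left (Real.exp_le_exp.2 ?_)
    (Finset.prod_nonneg fun n _ => zero_le_one.trans (one_le_acceleratedFactor n))
  have : 0 ≤ 1 / (2 * (k + i) : ℝ) ^ 2 := by positivity
  linarith

set_option maxRecDepth 10000 in
theorem prod_acceleratedFactor_bounds :
    1.276274 ≤ ∏ n ∈ Finset.range 280, acceleratedFactor n ∧
      ∏ n ∈ Finset.range 280, acceleratedFactor n ≤ 1.276275 := by
  norm_num [Finset.prod_range_succ, acceleratedFactor]

theorem bounds_of_hasProd {E : ℝ}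
    (hE : HasProd (fun p : Nat.Primes =>
      (p : ℝ) ^ (-3 : ℤ) * ((p : ℝ) - 1) ^ 2 * ((p : ℝ) + 2)) E) :
    0.471676 < (riemannZeta 2).re * E ∧ (riemannZeta 2).re * E < 0.471684 := by
  have hV := hasProd_acceleratedFactor hE
  obtain ⟨h1, h2⟩ := prod_acceleratedFactor_bounds
  have h3 := h1.trans (prod_le_of_hasProd_acceleratedFactor hV 280)
  have h4 := le_prod_of_hasProd_acceleratedFactor hV (k := 140) (by norm_num)
  -- The tail exponent is `1 / (2 · 280²) = 1 / 156800`.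
  have h5 : Real.exp (1 / (2 * (140 : ℕ) : ℝ) ^ 2 / 2) ≤ 1 / (1 - 1 / 156800) := by
    have := Real.exp_bound_div_one_sub_of_interval (x := 1 / 156800) (by norm_num) (by norm_num)
    norm_num at this ⊢
    exact this
  have h6 : E * (riemannZeta 2).re ^ 3 ≤ 1.276275 * (1 / (1 - 1 / 156800)) :=
    h4.trans (mul_le_mul h2 h5 (Real.exp_pos _).le (by norm_num))
  rw [riemannZeta_two_re] at h3 h6 ⊢
  have hpi1 := Real.pi_gt_d6
  have hpi2 := Real.pi_lt_d6
  set W := Real.pi ^ 2 / 6 * E with hW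
  have hsq1 : (3.141592 : ℝ) ^ 4 < Real.pi ^ 4 := by gcongr
  have hsq2 : Real.pi ^ 4 < (3.141593 : ℝ) ^ 4 := by gcongr
  -- The wanted quantity is the accelerated product divided by `ζ(2)² = π⁴/36`.
  have hWV : E * (Real.pi ^ 2 / 6) ^ 3 = W * (Real.pi ^ 4 / 36) := by rw [hW]; ring
  rw [hWV] at h3 h6
  have hpos : 0 < Real.pi ^ 4 / 36 := by positivity
  constructor
  · by_contra hlt
    have : W * (Real.pi ^ 4 / 36) ≤ 0.471676 * (Real.pi ^ 4 / 36) :=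
      mul_le_mul_of_nonneg_right (not_lt.1 hlt) hpos.le
    norm_num at this h3 hsq2
    linarith
  · by_contra hlt
    have : 0.471684 * (Real.pi ^ 4 / 36) ≤ W * (Real.pi ^ 4 / 36) :=
      mul_le_mul_of_nonneg_right (not_lt.1 hlt) hpos.le
    norm_num at this h6 hsq1
    linarith

/-! ### Passage to the limiting proportions -/

theorem sum_range_ceil_eq_sum_Ioc (f : ArithmeticFunction ℝ) (X : ℝ) :
    ∑ n ∈ Finset.range ⌈X⌉₊, f n = ∑ n ∈ Finset.Ioc 0 (⌈X⌉₊ - 1), f n := by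
  symm
  refine Finset.sum_subset (fun n hn => ?_) fun n hn hn' => ?_
  · simp only [Finset.mem_Ioc, Finset.mem_range] at hn ⊢
    omega
  · simp only [Finset.mem_Ioc, Finset.mem_range] at hn hn'
    obtain rfl : n = 0 := by omega
    simp

theorem tendsto_ceil_sub_one : Tendsto (fun X : ℝ => ⌈X⌉₊ - 1) atTop atTop :=
  (tendsto_sub_atTop_nat 1).comp tendsto_nat_ceil_atTop

theorem tendsto_sum_div {f : ArithmeticFunction ℝ}
    (h : Summable fun n : ℕ => |moebiusCubed f n / n|) :
    Tendsto (fun N : ℕ => (∑ n ∈ Finset.Ioc 0 N, f n) / (N * divisorLogSum N)) atTop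
      (𝓝 (∑' n : ℕ, moebiusCubed f n / n)) := by
  have := tendsto_sum_mul_zeta_pow_three (moebiusCubed f) (by simpa [abs_div] using h)
  rwa [moebiusCubed_mul_zeta_pow_three] at this

theorem tendsto_cocyclic_ratio :
    Tendsto (fun N : ℕ => (∑ n ∈ Finset.Ioc 0 N, cocyclicCount n) /
      ∑ n ∈ Finset.Ioc 0 N, subringCount n) atTop
      (𝓝 ((riemannZeta 2).re * ∑' n : ℕ, moebiusCubed cocyclicCount n / n)) := by
  have hz := riemannZeta_two_mul_tsum_subring
  have h := (tendsto_sum_div summable_moebiusCubed_cocyclicCount).div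
    (tendsto_sum_div summable_moebiusCubed_subringCount) (right_ne_zero_of_mul_eq_one hz)
  have e : (∑' n : ℕ, moebiusCubed cocyclicCount n / n) / ∑' n : ℕ, moebiusCubed subringCount n / n =
      (riemannZeta 2).re * ∑' n : ℕ, moebiusCubed cocyclicCount n / n := by
    rw [div_eq_inv_mul, inv_eq_of_mul_eq_one_left hz]
  rw [e] at h
  refine h.congr' ?_
  filter_upwards [eventually_divisorLogSum_pos, eventually_gt_atTop 0] with N hT hN
  have hN' : (0 : ℝ) < N := by exact_mod_cast hN
  -- The common scale `N * divisorLogSum N` cancels.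
  exact div_div_div_cancel_right₀ (by positivity) _ _

theorem tendsto_subringProportion_isCocyclic :
    Tendsto (subringProportion 3 IsCocyclic) atTop
      (𝓝 ((riemannZeta 2).re * ∑' n : ℕ, moebiusCubed cocyclicCount n / n)) := by
  refine (tendsto_cocyclic_ratio.comp tendsto_ceil_sub_one).congr fun X => ?_
  rw [subringProportion, ncard_isCocyclic_eq, ncard_subringsBelow_eq, sum_range_ceil_eq_sum_Ioc,
    sum_range_ceil_eq_sum_Ioc]
  rfl

theorem sum_subringCount_pos {N : ℕ} (hN : 0 < N) : 0 < ∑ n ∈ Finset.Ioc 0 N, subringCount n := by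
  refine Finset.sum_pos' (fun n _ => ?_) ⟨1, by simp; omega, ?_⟩
  · rw [subringCount, antidiagonalSum_apply]
    positivity
  · rw [isMultiplicative_subringCount.1]
    exact one_pos

theorem tendsto_subringProportion_hasCorank_two :
    Tendsto (subringProportion 3 fun R => HasCorank R 2) atTop
      (𝓝 (1 - (riemannZeta 2).re * ∑' n : ℕ, moebiusCubed cocyclicCount n / n)) := by
  refine (tendsto_subringProportion_isCocyclic.const_sub 1).congr' ?_
  filter_upwards [tendsto_ceil_sub_one.eventually_gt_atTop 0] with X hX
  have := sum_subringCount_pos hX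
  rw [subringProportion, subringProportion, ncard_hasCorank_two_eq, ncard_isCocyclic_eq,
    ncard_subringsBelow_eq, sum_range_ceil_eq_sum_Ioc, sum_range_ceil_eq_sum_Ioc]
  field_simp

theorem mainTheorem12 :
    ∃ E : ℝ,
      HasProd (fun p : Nat.Primes =>
        (p : ℝ) ^ (-3 : ℤ) * ((p : ℝ) - 1) ^ 2 * ((p : ℝ) + 2)) E ∧
      Filter.Tendsto (subringProportion 3 IsCocyclic) Filter.atTop
        (nhds ((riemannZeta 2).re * E)) ∧
      Filter.Tendsto (subringProportion 3 (HasCorankAtMost 1)) Filter.atTop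
        (nhds ((riemannZeta 2).re * E)) ∧
      |(riemannZeta 2).re * E - 0.47168| < 0.000005 ∧
      Filter.Tendsto (subringProportion 3 (fun R => HasCorank R 2)) Filter.atTop
        (nhds (1 - (riemannZeta 2).re * E)) ∧
      |(1 - (riemannZeta 2).re * E) - 0.52832| < 0.000005 := by
  obtain ⟨h1, h2⟩ := bounds_of_hasProd hasProd_cocyclic
  refine ⟨_, hasProd_cocyclic, tendsto_subringProportion_isCocyclic, ?_, ?_,
    tendsto_subringProportion_hasCorank_two, ?_⟩
  · have : (HasCorankAtMost 1 : Subring (Fin 3 → ℤ) → Prop) = IsCocyclic :=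
      funext fun R => propext (isCocyclic_iff_hasCorankAtMost_one R).symm
    rw [this]
    exact tendsto_subringProportion_isCocyclic
  · rw [abs_lt]
    constructor <;> linarith
  · rw [abs_lt]
    constructor <;> linarith
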